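/- **Setting.** All manifolds are smooth, finite dimensional and without boundary. Let $(\tilde M,J,g)$ be a locally conformal Kaehler (LCK) manifold: a complex manifold $(\tilde M,J)$ with a Hermitian metric $g$ such that every point has an open neighbourhood $U$ and a smooth $\sigma:U\to\mathbb R$ for which the metric $e^{-\sigma}g|_U$ is Kaehler, i.e. $\nabla^{*}J=0$ for its Levi-Civita connection $\nabla^{*}$. Let $\Omega(X,Y)=g(X,JY)$, and let $\alpha$ be the Lee form, i.e. the closed smooth $1$-form with $d\Omega=2\,\alpha\wedge\Omega$. (Equivalently, with this normalization, $(\tilde\nabla_XJ)Y=g(\lambda,JY)X-g(\lambda,Y)JX+g(JX,Y)\lambda+g(X,Y)J\lambda$, where $\tilde\nabla$ is the Levi-Civita connection of $g$ and $\lambda=\alpha^{\#}$.) Let $(N^T,g_1)$ and $(N^\theta,g_2)$ be Riemannian manifolds with $\dim N^\theta\ge 1$, let $f$ be a positive smooth function on $N^T$, and let $M=N^T\times_fN^\theta$ be the warped product, i.e. $N^T\times N^\theta$ with the metric $\pi_1^*g_1+(f\circ\pi_1)^2\pi_2^*g_2$. Let $M$ be isometrically immersed in $\tilde M$, and let $\mathfrak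 D$, $\mathfrak D^\theta$ be the distributions on $M$ tangent to the factors $N^T$, $N^\theta$. Suppose that $M$ is *pointwise semi-slant*: $J\mathfrak D=\mathfrak D$, and there is a function $\theta:M\to[0,\pi/2]$ such that at every $p\in M$ the angle between $JZ$ and $\mathfrak D^\theta_p$ is $\theta(p)$ for every nonzero $Z\in\mathfrak D^\theta_p$. It is *proper* if $\dim N^T>0$ and $\cos^2\theta>0$ everywhere. Let $h$ be the second fundamental form of $M$ in $\tilde M$, let $FZ$ be the normal component of $JZ$ for $Z$ tangent to $M$, and let $\nu$ be the orthogonal complement of $F\mathfrak D^\theta$ in the normal bundle $T^\perp M$. **Theorem.** (a) If $M$ is proper and $h(X,Z)\in\nu$ for all $X\in\mathfrak D$ and $Z\in\mathfrak D^\theta$, then $\alpha(X)=X(\ln f)$ for all $X\in\mathfrak D$. (b) If $M$ is mixed totally geodesic, i.e. $h(X,Z)=0$ for all $X\in\mathfrak D$ and $Z\in\mathfrak D^\theta$, then $\alpha(X)=X(\ln f)$ for all $X\in\mathfrak D$. -/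

import Mathlib

open scoped Manifold ContDiff

noncomputable section

namespace LCK

/-! ### Tensor calculus in the preferred charts

All manifolds are smooth, real, finite dimensional and without boundary. The tangent space at `x` is
identified with the model space `E` through the preferred chart at `x`; every differential expression
at `x` below is its classical coordinate expression in that chart, evaluated at `x`. -/

section Ambient

variable {E : Type*} [NormedAddCommGroup E] [NormedSpace ℝ E]
  {M : Type*} [TopologicalSpace M] [ChartedSpace E M]

/-- The vector `c` with `B(c, w) = ℓ(w)` for all `w` (it exists and is unique when `B` is an inner
product on a finite dimensional space and `ℓ` is linear). -/
def dualVector {V : Type*} [AddCommGroup V] (B : V → V → ℝ) (ℓ : V → ℝ) : V :=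
  Classical.epsilon fun c => ∀ w, B c w = ℓ w

/-- The coordinate vector field with constant components `v` of the chart at `x`, at the point with
coordinates `y`. -/
def coordVec (x : M) (y v : E) : TangentSpace 𝓘(ℝ, E) ((extChartAt 𝓘(ℝ, E) x).symm y) :=
  mfderiv 𝓘(ℝ, E) 𝓘(ℝ, E) (extChartAt 𝓘(ℝ, E) x).symm y v

/-- The components, in the chart at `x`, of a tangent vector `V` at `z`. -/
def components (x : M) {z : M} (V : TangentSpace 𝓘(ℝ, E) z) : E :=
  mfderiv 𝓘(ℝ, E) 𝓘(ℝ, E) (extChartAt 𝓘(ℝ, E) x) z V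

/-- `∂_u (α(v))` at `x`, for a 1-form `α` and coordinate fields `u`, `v`. -/
def partialOneForm (α : (x : M) → TangentSpace 𝓘(ℝ, E) x → ℝ) (x : M)
    (u v : TangentSpace 𝓘(ℝ, E) x) : ℝ :=
  fderiv ℝ (fun y : E => α _ (coordVec x y v)) (extChartAt 𝓘(ℝ, E) x x) u

/-- `∂_u (B(v, w))` at `x`, for a field of bilinear forms `B` and coordinate fields `u`, `v`, `w`. -/
def partialBilin (B : (x : M) → TangentSpace 𝓘(ℝ, E) x → TangentSpace 𝓘(ℝ, E) x → ℝ) (x : M)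
    (u v w : TangentSpace 𝓘(ℝ, E) x) : ℝ :=
  fderiv ℝ (fun y : E => B _ (coordVec x y v) (coordVec x y w)) (extChartAt 𝓘(ℝ, E) x x) u

/-- `∂_u (J v)` at `x`, for a field of endomorphisms `J` and coordinate fields `u`, `v`. -/
def partialEndo (J : (x : M) → TangentSpace 𝓘(ℝ, E) x →L[ℝ] TangentSpace 𝓘(ℝ, E) x) (x : M)
    (u v : TangentSpace 𝓘(ℝ, E) x) : TangentSpace 𝓘(ℝ, E) x :=
  fderiv ℝ (fun y : E => components x (J _ (coordVec x y v))) (extChartAt 𝓘(ℝ, E) x x) u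

/-- The Christoffel symbol `Γ(u, v)` at `x` of the Levi-Civita connection of the metric `B`:
`B(Γ(u, v), w) = ½ (∂_u B(v, w) + ∂_v B(u, w) - ∂_w B(u, v))`. -/
def christoffel (B : (x : M) → TangentSpace 𝓘(ℝ, E) x → TangentSpace 𝓘(ℝ, E) x → ℝ) (x : M)
    (u v : TangentSpace 𝓘(ℝ, E) x) : TangentSpace 𝓘(ℝ, E) x :=
  dualVector (B x) fun w =>
    (partialBilin B x u v w + partialBilin B x v u w - partialBilin B x w u v) / 2

/-- `(∇_u J) v = ∇_u (J v) - J (∇_u v)`, with `∇` the Levi-Civita connection of the metric `B`. -/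
def covDerivEndo (B : (x : M) → TangentSpace 𝓘(ℝ, E) x → TangentSpace 𝓘(ℝ, E) x → ℝ)
    (J : (x : M) → TangentSpace 𝓘(ℝ, E) x →L[ℝ] TangentSpace 𝓘(ℝ, E) x) (x : M)
    (u v : TangentSpace 𝓘(ℝ, E) x) : TangentSpace 𝓘(ℝ, E) x :=
  partialEndo J x u v + christoffel B x u (J x v) - J x (christoffel B x u v)

/-- The Nijenhuis tensor `N(u, v) = [Ju, Jv] - J[Ju, v] - J[u, Jv] - [u, v]`, evaluated on coordinate
fields `u`, `v`. -/
def nijenhuis (J : (x : M) → TangentSpace 𝓘(ℝ, E) x →L[ℝ] TangentSpace 𝓘(ℝ, E) x) (x : M)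
    (u v : TangentSpace 𝓘(ℝ, E) x) : TangentSpace 𝓘(ℝ, E) x :=
  (partialEndo J x (J x u) v - partialEndo J x (J x v) u) + J x (partialEndo J x v u)
    - J x (partialEndo J x u v)

variable [IsManifold 𝓘(ℝ, E) ∞ M]

/-- `J` is a complex structure: a smooth, integrable almost complex structure. -/
structure IsComplexStructure
    (J : (x : M) → TangentSpace 𝓘(ℝ, E) x →L[ℝ] TangentSpace 𝓘(ℝ, E) x) : Prop where
  smooth : ContMDiff 𝓘(ℝ, E) (𝓘(ℝ, E).prod 𝓘(ℝ, E →L[ℝ] E)) ∞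
    (fun x => Bundle.TotalSpace.mk' (E →L[ℝ] E)
      (E := fun x : M => TangentSpace 𝓘(ℝ, E) x →L[ℝ] TangentSpace 𝓘(ℝ, E) x) x (J x))
  sq : ∀ x v, J x (J x v) = -v
  integrable : ∀ x u v, nijenhuis J x u v = 0

/-- A smooth Riemannian metric on `M`. -/
abbrev Metric (E M : Type*) [NormedAddCommGroup E] [NormedSpace ℝ E] [TopologicalSpace M]
    [ChartedSpace E M] [IsManifold 𝓘(ℝ, E) ∞ M] :=
  Bundle.ContMDiffRiemannianMetric 𝓘(ℝ, E) ∞ E (fun x : M => TangentSpace 𝓘(ℝ, E) x)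

/-- `(M, J, g)` is a locally conformal Kaehler manifold: `(M, J)` is a complex manifold, `g` is
Hermitian, and around every point there is a smooth function `σ` on an open set `U` such that the
metric `e^{-σ} g` on `U` is Kaehler, i.e. `J` is parallel for its Levi-Civita connection. -/
structure IsLCK (g : Metric E M)
    (J : (x : M) → TangentSpace 𝓘(ℝ, E) x →L[ℝ] TangentSpace 𝓘(ℝ, E) x) : Prop where
  complex : IsComplexStructure J
  hermitian : ∀ x u v, g.inner x (J x u) (J x v) = g.inner x u v
  locallyConformal : ∀ x : M, ∃ U : Set M, IsOpen U ∧ x ∈ U ∧ ∃ σ : M → ℝ,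
    ContMDiffOn 𝓘(ℝ, E) 𝓘(ℝ, ℝ) ∞ σ U ∧
    ∀ y ∈ U, ∀ u v, covDerivEndo (fun z a b => Real.exp (-σ z) * g.inner z a b) J y u v = 0

/-- The fundamental 2-form `Ω(u, v) = g(u, J v)`. -/
def fundamentalForm (g : Metric E M)
    (J : (x : M) → TangentSpace 𝓘(ℝ, E) x →L[ℝ] TangentSpace 𝓘(ℝ, E) x)
    (x : M) (u v : TangentSpace 𝓘(ℝ, E) x) : ℝ :=
  g.inner x u (J x v)

/-- `α` is the Lee form of `(M, J, g)`: the smooth closed 1-form with `dΩ = 2 α ∧ Ω`, where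
`dΩ(u, v, w)` and `(α ∧ Ω)(u, v, w)` are the cyclic sums of `∂_u Ω(v, w)` and `α(u) Ω(v, w)`. -/
structure IsLeeForm (g : Metric E M)
    (J : (x : M) → TangentSpace 𝓘(ℝ, E) x →L[ℝ] TangentSpace 𝓘(ℝ, E) x)
    (α : (x : M) → TangentSpace 𝓘(ℝ, E) x →L[ℝ] ℝ) : Prop where
  smooth : ContMDiff 𝓘(ℝ, E) (𝓘(ℝ, E).prod 𝓘(ℝ, E →L[ℝ] ℝ)) ∞
    (fun x => Bundle.TotalSpace.mk' (E →L[ℝ] ℝ)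
      (E := fun x : M => TangentSpace 𝓘(ℝ, E) x →L[ℝ] ℝ) x (α x))
  closed : ∀ x u v,
    partialOneForm (fun z a => α z a) x u v - partialOneForm (fun z a => α z a) x v u = 0
  dOmega : ∀ x u v w,
    partialBilin (fundamentalForm g J) x u v w + partialBilin (fundamentalForm g J) x v w u
        + partialBilin (fundamentalForm g J) x w u v
      = 2 * (α x u * fundamentalForm g J x v w + α x v * fundamentalForm g J x w u
        + α x w * fundamentalForm g J x u v)

end Ambient

/-! ### Submanifolds, given by an immersion `φ : S → M` -/

section Submanifold

variable {E : Type*} [NormedAddCommGroup E] [NormedSpace ℝ E]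
  {M : Type*} [TopologicalSpace M] [ChartedSpace E M] [IsManifold 𝓘(ℝ, E) ∞ M]
  {F : Type*} [NormedAddCommGroup F] [NormedSpace ℝ F]
  {H : Type*} [TopologicalSpace H] (I : ModelWithCorners ℝ F H)
  {S : Type*} [TopologicalSpace S] [ChartedSpace H S]

/-- The induced metric `g(φ_* u, φ_* v)`. -/
def induced (g : Metric E M) (φ : S → M) (p : S) (u v : TangentSpace I p) : ℝ :=
  g.inner (φ p) (mfderiv I 𝓘(ℝ, E) φ p u) (mfderiv I 𝓘(ℝ, E) φ p v)

/-- The tangential component of `ξ ∈ T_{φ(p)} M`, as a vector of `T_p S`. -/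
def tangentialPart (g : Metric E M) (φ : S → M) (p : S) (ξ : TangentSpace 𝓘(ℝ, E) (φ p)) :
    TangentSpace I p :=
  dualVector (induced I g φ p) fun w => g.inner (φ p) ξ (mfderiv I 𝓘(ℝ, E) φ p w)

/-- The normal component of `ξ ∈ T_{φ(p)} M`. -/
def normalPart (g : Metric E M) (φ : S → M) (p : S) (ξ : TangentSpace 𝓘(ℝ, E) (φ p)) :
    TangentSpace 𝓘(ℝ, E) (φ p) :=
  ξ - mfderiv I 𝓘(ℝ, E) φ p (tangentialPart I g φ p ξ)

/-- `P u`, the tangential component of `J u`, for `u` tangent to `S`. -/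
def tanJ (g : Metric E M)
    (J : (x : M) → TangentSpace 𝓘(ℝ, E) x →L[ℝ] TangentSpace 𝓘(ℝ, E) x)
    (φ : S → M) (p : S) (u : TangentSpace I p) : TangentSpace I p :=
  tangentialPart I g φ p (J (φ p) (mfderiv I 𝓘(ℝ, E) φ p u))

/-- `F u`, the normal component of `J u`, for `u` tangent to `S`. -/
def norJ (g : Metric E M)
    (J : (x : M) → TangentSpace 𝓘(ℝ, E) x →L[ℝ] TangentSpace 𝓘(ℝ, E) x)
    (φ : S → M) (p : S) (u : TangentSpace I p) : TangentSpace 𝓘(ℝ, E) (φ p) :=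
  normalPart I g φ p (J (φ p) (mfderiv I 𝓘(ℝ, E) φ p u))

/-- `∇̃_u (φ_* v)`, the Levi-Civita derivative in `M` (along `φ`) of the image of the coordinate field
with components `v` of the chart of `S` at `p`: in coordinates, `D²φ(u, v) + Γ(φ_* u, φ_* v)`. -/
def ambientDeriv (g : Metric E M) (φ : S → M) (p : S) (u v : TangentSpace I p) :
    TangentSpace 𝓘(ℝ, E) (φ p) :=
  (show TangentSpace 𝓘(ℝ, E) (φ p) from
      fderiv ℝ (fderiv ℝ (writtenInExtChartAt I 𝓘(ℝ, E) p φ)) (extChartAt I p p) u v)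
    + christoffel (fun z a b => g.inner z a b) (φ p)
        (mfderiv I 𝓘(ℝ, E) φ p u) (mfderiv I 𝓘(ℝ, E) φ p v)

/-- The second fundamental form `h(u, v)`: the normal component of `∇̃_u v` (Gauss formula). -/
def secondFundamentalForm (g : Metric E M) (φ : S → M) (p : S) (u v : TangentSpace I p) :
    TangentSpace 𝓘(ℝ, E) (φ p) :=
  normalPart I g φ p (ambientDeriv I g φ p u v)

/-- `ξ` lies in `ν_p`, the orthogonal complement of `F 𝔇^θ` in the normal space at `p`. -/
def MemNu (g : Metric E M)
    (J : (x : M) → TangentSpace 𝓘(ℝ, E) x →L[ℝ] TangentSpace 𝓘(ℝ, E) x)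
    (φ : S → M) (Dθ : (p : S) → Submodule ℝ (TangentSpace I p)) (p : S)
    (ξ : TangentSpace 𝓘(ℝ, E) (φ p)) : Prop :=
  (∀ w, g.inner (φ p) ξ (mfderiv I 𝓘(ℝ, E) φ p w) = 0) ∧
    ∀ Z ∈ Dθ p, g.inner (φ p) ξ (norJ I g J φ p Z) = 0

/-- `S` is pointwise semi-slant with holomorphic distribution `D`, pointwise slant distribution `Dθ`
and slant function `θ`. By `orthogonal` and `holomorphic`, the tangential component `P Z` of `J Z` is
its orthogonal projection to `Dθ p` for `Z ∈ Dθ p`, and `|J Z| = |Z|`; so `slant` says that the angle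
between `J Z` and `Dθ p` is `θ p`, whatever the nonzero vector `Z ∈ Dθ p`. -/
structure IsPointwiseSemiSlant (g : Metric E M)
    (J : (x : M) → TangentSpace 𝓘(ℝ, E) x →L[ℝ] TangentSpace 𝓘(ℝ, E) x)
    (φ : S → M) (D Dθ : (p : S) → Submodule ℝ (TangentSpace I p)) (θ : S → ℝ) : Prop where
  isCompl : ∀ p, IsCompl (D p) (Dθ p)
  orthogonal : ∀ p, ∀ X ∈ D p, ∀ Z ∈ Dθ p, induced I g φ p X Z = 0
  holomorphic : ∀ p,
    ((D p).map (mfderiv I 𝓘(ℝ, E) φ p).toLinearMap).map (J (φ p)).toLinearMap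
      = (D p).map (mfderiv I 𝓘(ℝ, E) φ p).toLinearMap
  angle_mem : ∀ p, θ p ∈ Set.Icc 0 (Real.pi / 2)
  slant : ∀ p, ∀ Z ∈ Dθ p,
    induced I g φ p (tanJ I g J φ p Z) (tanJ I g J φ p Z)
      = Real.cos (θ p) ^ 2 * induced I g φ p Z Z

/-- `h(X, Z) = 0` for all `X ∈ D` and `Z ∈ Dθ`. -/
def IsMixedTotallyGeodesic (g : Metric E M) (φ : S → M)
    (D Dθ : (p : S) → Submodule ℝ (TangentSpace I p)) : Prop :=
  ∀ p, ∀ X ∈ D p, ∀ Z ∈ Dθ p, secondFundamentalForm I g φ p X Z = 0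

end Submanifold

/-! ### Warped products `N₁ ×_f N₂` -/

section Warped

variable {E : Type*} [NormedAddCommGroup E] [NormedSpace ℝ E]
  {M : Type*} [TopologicalSpace M] [ChartedSpace E M] [IsManifold 𝓘(ℝ, E) ∞ M]
  {E₁ : Type*} [NormedAddCommGroup E₁] [NormedSpace ℝ E₁]
  {N₁ : Type*} [TopologicalSpace N₁] [ChartedSpace E₁ N₁] [IsManifold 𝓘(ℝ, E₁) ∞ N₁]
  {E₂ : Type*} [NormedAddCommGroup E₂] [NormedSpace ℝ E₂]
  {N₂ : Type*} [TopologicalSpace N₂] [ChartedSpace E₂ N₂] [IsManifold 𝓘(ℝ, E₂) ∞ N₂]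

/-- The warped product metric `g₁(π₁_* u, π₁_* v) + (f ∘ π₁)² g₂(π₂_* u, π₂_* v)`. -/
def warpedMetric (g₁ : Metric E₁ N₁) (g₂ : Metric E₂ N₂) (f : N₁ → ℝ) (p : N₁ × N₂)
    (u v : TangentSpace (𝓘(ℝ, E₁).prod 𝓘(ℝ, E₂)) p) : ℝ :=
  g₁.inner p.1 (mfderiv (𝓘(ℝ, E₁).prod 𝓘(ℝ, E₂)) 𝓘(ℝ, E₁) Prod.fst p u)
      (mfderiv (𝓘(ℝ, E₁).prod 𝓘(ℝ, E₂)) 𝓘(ℝ, E₁) Prod.fst p v)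
    + f p.1 ^ 2 * g₂.inner p.2 (mfderiv (𝓘(ℝ, E₁).prod 𝓘(ℝ, E₂)) 𝓘(ℝ, E₂) Prod.snd p u)
      (mfderiv (𝓘(ℝ, E₁).prod 𝓘(ℝ, E₂)) 𝓘(ℝ, E₂) Prod.snd p v)

/-- The distribution of vectors tangent to the first factor. -/
def firstDist (E₁ E₂ : Type*) [NormedAddCommGroup E₁] [NormedSpace ℝ E₁]
    [NormedAddCommGroup E₂] [NormedSpace ℝ E₂] {N₁ N₂ : Type*}
    [TopologicalSpace N₁] [ChartedSpace E₁ N₁] [TopologicalSpace N₂] [ChartedSpace E₂ N₂]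
    (p : N₁ × N₂) : Submodule ℝ (TangentSpace (𝓘(ℝ, E₁).prod 𝓘(ℝ, E₂)) p) :=
  LinearMap.ker (mfderiv (𝓘(ℝ, E₁).prod 𝓘(ℝ, E₂)) 𝓘(ℝ, E₂) Prod.snd p).toLinearMap

/-- The distribution of vectors tangent to the second factor. -/
def secondDist (E₁ E₂ : Type*) [NormedAddCommGroup E₁] [NormedSpace ℝ E₁]
    [NormedAddCommGroup E₂] [NormedSpace ℝ E₂] {N₁ N₂ : Type*}
    [TopologicalSpace N₁] [ChartedSpace E₁ N₁] [TopologicalSpace N₂] [ChartedSpace E₂ N₂]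
    (p : N₁ × N₂) : Submodule ℝ (TangentSpace (𝓘(ℝ, E₁).prod 𝓘(ℝ, E₂)) p) :=
  LinearMap.ker (mfderiv (𝓘(ℝ, E₁).prod 𝓘(ℝ, E₂)) 𝓘(ℝ, E₁) Prod.fst p).toLinearMap

/-- `φ` realizes the warped product `N₁ ×_f N₂` (with factors `N₁ = N^T` and `N₂ = N^θ`) as a
pointwise semi-slant warped product in `(M, J, g)` with slant function `θ`: it is a smooth isometric
immersion of `N₁ ×_f N₂`, and it is pointwise semi-slant for the tangent distributions `𝔇`, `𝔇^θ` of
the two factors. -/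
structure IsSemiSlantWarpedProduct (g : Metric E M)
    (J : (x : M) → TangentSpace 𝓘(ℝ, E) x →L[ℝ] TangentSpace 𝓘(ℝ, E) x)
    (g₁ : Metric E₁ N₁) (g₂ : Metric E₂ N₂) (f : N₁ → ℝ) (φ : N₁ × N₂ → M)
    (θ : N₁ × N₂ → ℝ) : Prop where
  warping_smooth : ContMDiff 𝓘(ℝ, E₁) 𝓘(ℝ, ℝ) ∞ f
  warping_pos : ∀ x, 0 < f x
  smooth : ContMDiff (𝓘(ℝ, E₁).prod 𝓘(ℝ, E₂)) 𝓘(ℝ, E) ∞ φ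
  isometric : ∀ p u v,
    induced (𝓘(ℝ, E₁).prod 𝓘(ℝ, E₂)) g φ p u v = warpedMetric g₁ g₂ f p u v
  semiSlant : IsPointwiseSemiSlant (𝓘(ℝ, E₁).prod 𝓘(ℝ, E₂)) g J φ
    (firstDist E₁ E₂) (secondDist E₁ E₂) θ

end Warped

end LCK

end

/-! Take `X` in `𝔇` and `Z` in `𝔇^θ`, extended as coordinate fields of a product chart. Since `J𝔇 =
𝔇` is orthogonal to `𝔇^θ`, the function `g(JX, Z)` vanishes on a neighbourhood of the point.
Differentiating it along `Z` with the Levi-Civita connection of `g` gives `0 = g((∇_Z J)X, Z) +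
g(J∇_Z X, Z) + g(JX, ∇_Z Z)`, and the three terms are computed separately.

The first is `α(JX) |Z|²` (`IsLCK.rawMetric_covDeriv`). For a local Kaehler metric `e^{-σ}g` the
connection `∇*` satisfies `∇*J = 0`, so `dΩ = dσ ∧ Ω`. Comparison with `dΩ = 2 α ∧ Ω` identifies
`dσ(JX)` with `2 α(JX)`, and the conformal change formula for `∇ - ∇*` does the rest.

The second is `-g(∇_X Z, JZ)`, because `J` is skew and coordinate fields commute. The tangential
part of `∇_X Z` is `X(ln f) Z`, which is orthogonal to `JZ`; the normal part contributes `g(h(X, Z),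
FZ)`, which vanishes under either hypothesis (`rawMetric_rawAmbientDeriv_rawEndo`).

The third is `-(JX)(ln f) |Z|²`, by the Koszul formula for the warped metric
(`rawMetric_rawAmbientDeriv_second`).

Hence `α(JX) = (JX)(ln f)` once `Z ≠ 0`, and `JX` ranges over all of `𝔇` (`leeForm_eq`). -/

noncomputable section

namespace LCK

/-! ### Metric and complex structure in a chart, and their first derivatives. -/

section Coordinates

variable {E : Type*} [NormedAddCommGroup E] [NormedSpace ℝ E]
  {M : Type*} [TopologicalSpace M] [ChartedSpace E M]

/-- The derivative of the chart at `x`, as an endomorphism of the model space. -/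
def chartDeriv (x z : M) : E →L[ℝ] E :=
  mfderiv 𝓘(ℝ, E) 𝓘(ℝ, E) (extChartAt 𝓘(ℝ, E) x) z

/-- The derivative of the inverse of the chart at `x`, as an endomorphism of the model space. -/
def chartSymmDeriv (x : M) (y : E) : E →L[ℝ] E :=
  mfderiv 𝓘(ℝ, E) 𝓘(ℝ, E) (extChartAt 𝓘(ℝ, E) x).symm y

/-- An endomorphism field, with all tangent spaces identified with the model space. -/
def rawEndo (J : (x : M) → TangentSpace 𝓘(ℝ, E) x →L[ℝ] TangentSpace 𝓘(ℝ, E) x) (x : M) :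
    E →L[ℝ] E :=
  J x

/-- The matrix of the endomorphism field `J` in the chart at `x`. -/
def coordEndo (J : (x : M) → TangentSpace 𝓘(ℝ, E) x →L[ℝ] TangentSpace 𝓘(ℝ, E) x) (x : M) (y : E) :
    E →L[ℝ] E :=
  chartDeriv x ((extChartAt 𝓘(ℝ, E) x).symm y) ∘L rawEndo J ((extChartAt 𝓘(ℝ, E) x).symm y) ∘L
    chartSymmDeriv x y

variable [IsManifold 𝓘(ℝ, E) ∞ M]

/-- A metric, with all tangent spaces identified with the model space. -/
def rawMetric (g : Metric E M) (x : M) : E →L[ℝ] E →L[ℝ] ℝ :=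
  g.inner x

lemma rawMetric_symm (g : Metric E M) (x : M) (v w : E) :
    rawMetric g x v w = rawMetric g x w v :=
  g.symm x v w

lemma rawMetric_pos (g : Metric E M) (x : M) {v : E} (hv : v ≠ 0) : 0 < rawMetric g x v v :=
  g.pos x v hv

/-- The matrix of the metric `g` in the chart at `x`. -/
def coordMetric (g : Metric E M) (x : M) (y : E) : E →L[ℝ] E →L[ℝ] ℝ :=
  (rawMetric g ((extChartAt 𝓘(ℝ, E) x).symm y)).bilinearComp
    (chartSymmDeriv x y) (chartSymmDeriv x y)

/-- The tangent space at `x` is identified with `E` through this very chart. Together with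
`chartDeriv_self`, this makes coordinate matrices at the base point coincide with the tensors
themselves. -/
lemma chartSymmDeriv_self (x : M) :
    chartSymmDeriv x (extChartAt 𝓘(ℝ, E) x x) = ContinuousLinearMap.id ℝ E := by
  have := mfderivWithin_range_extChartAt_symm (I := 𝓘(ℝ, E)) (x := x)
  simp only [modelWithCornersSelf_coe, Set.range_id, mfderivWithin_univ] at this
  exact this

lemma chartDeriv_self (x : M) : chartDeriv x x = ContinuousLinearMap.id ℝ E :=
  mfderiv_extChartAt_self (I := 𝓘(ℝ, E)) (x := x)

lemma chartSymmDeriv_chartDeriv {x : M} {y : E} (hy : y ∈ (extChartAt 𝓘(ℝ, E) x).target) (v : E) :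
    chartSymmDeriv x y (chartDeriv x ((extChartAt 𝓘(ℝ, E) x).symm y) v) = v := by
  have := mfderivWithin_extChartAt_symm_comp_mfderiv_extChartAt (I := 𝓘(ℝ, E)) (x := x) hy
  simp only [modelWithCornersSelf_coe, Set.range_id, mfderivWithin_univ] at this
  exact DFunLike.congr_fun this v

lemma chartSymmDeriv_coordEndo
    (J : (x : M) → TangentSpace 𝓘(ℝ, E) x →L[ℝ] TangentSpace 𝓘(ℝ, E) x) {x : M} {y : E}
    (hy : y ∈ (extChartAt 𝓘(ℝ, E) x).target) (v : E) :
    chartSymmDeriv x y (coordEndo J x y v)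
      = rawEndo J ((extChartAt 𝓘(ℝ, E) x).symm y) (chartSymmDeriv x y v) :=
  chartSymmDeriv_chartDeriv hy _

lemma coordMetric_self (g : Metric E M) (x : M) :
    coordMetric g x (extChartAt 𝓘(ℝ, E) x x) = rawMetric g x := by
  ext v w
  simp only [coordMetric, chartSymmDeriv_self, ContinuousLinearMap.bilinearComp_apply,
    ContinuousLinearMap.id_apply, extChartAt_to_inv]

lemma coordEndo_self
    (J : (x : M) → TangentSpace 𝓘(ℝ, E) x →L[ℝ] TangentSpace 𝓘(ℝ, E) x) (x : M) :
    coordEndo J x (extChartAt 𝓘(ℝ, E) x x) = rawEndo J x := by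
  ext v
  simp only [coordEndo, chartSymmDeriv_self, ContinuousLinearMap.comp_apply,
    ContinuousLinearMap.id_apply, extChartAt_to_inv, chartDeriv_self]

lemma hasMFDerivAt_extChartAt_symm {x : M} {y : E} (hy : y ∈ (extChartAt 𝓘(ℝ, E) x).target) :
    HasMFDerivAt 𝓘(ℝ, E) 𝓘(ℝ, E) (extChartAt 𝓘(ℝ, E) x).symm y (chartSymmDeriv (E := E) x y) :=
  (((contMDiffOn_extChartAt_symm (n := ∞) x).contMDiffAt
    ((isOpen_extChartAt_target x).mem_nhds hy)).mdifferentiableAt (by simp)).hasMFDerivAt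

/-- A coordinate field is the tangent map of the inverse chart applied to a constant section, hence
smooth. -/
lemma contMDiffOn_coordVec (x : M) (v : E) :
    ContMDiffOn 𝓘(ℝ, E) 𝓘(ℝ, E).tangent ∞
      (fun y => (⟨_, coordVec x y v⟩ : TangentBundle 𝓘(ℝ, E) M)) (extChartAt 𝓘(ℝ, E) x).target := by
  have h1 := (contMDiffOn_extChartAt_symm (I := 𝓘(ℝ, E)) (n := ∞) x).contMDiffOn_tangentMapWithin
    (m := ∞) (by simp) (isOpen_extChartAt_target x).uniqueMDiffOn
  have h2 : ContMDiff 𝓘(ℝ, E) 𝓘(ℝ, E).tangent ∞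
      (fun y : E => (⟨y, v⟩ : TangentBundle 𝓘(ℝ, E) E)) := by
    intro y
    rw [contMDiffAt_vectorSpace_iff_contDiffAt (V := fun _ : E => v)]
    exact contDiffAt_const
  refine (h1.comp h2.contMDiffOn fun y hy => hy).congr fun y hy => ?_
  simp only [Function.comp_apply, tangentMapWithin]
  rw [mfderivWithin_of_isOpen (isOpen_extChartAt_target x) hy]
  rfl

/-- In finite dimension smoothness can be tested on fixed vectors, where the matrix entries are the
metric paired with two smooth coordinate fields. -/
lemma contDiffOn_coordMetric [FiniteDimensional ℝ E] (g : Metric E M) (x : M) :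
    ContDiffOn ℝ ∞ (coordMetric g x) (extChartAt 𝓘(ℝ, E) x).target := by
  rw [contDiffOn_clm_apply]
  intro v
  rw [contDiffOn_clm_apply]
  intro w
  rw [← contMDiffOn_iff_contDiffOn]
  have hg := g.contMDiff.comp_contMDiffOn (contMDiffOn_extChartAt_symm (I := 𝓘(ℝ, E)) (n := ∞) x)
  have h (y) (hy : y ∈ (extChartAt 𝓘(ℝ, E) x).target) :
    ContMDiffWithinAt 𝓘(ℝ, E) (𝓘(ℝ, E).prod 𝓘(ℝ)) ∞
      (fun m ↦ Bundle.TotalSpace.mk' ℝ (E := Bundle.Trivial M ℝ) ((extChartAt 𝓘(ℝ, E) x).symm m)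
        (g.inner _ (coordVec x m v) (coordVec x m w))) (extChartAt 𝓘(ℝ, E) x).target y := by
    apply ContMDiffWithinAt.clm_bundle_apply₂ (F₁ := E) (F₂ := E)
    · exact hg y hy
    · exact contMDiffOn_coordVec x v y hy
    · exact contMDiffOn_coordVec x w y hy
  intro y hy
  have := h y hy
  simp only [Bundle.contMDiffWithinAt_totalSpace] at this
  exact this.2

lemma differentiableAt_coordMetric [FiniteDimensional ℝ E] (g : Metric E M) (x : M) :
    DifferentiableAt ℝ (coordMetric g x) (extChartAt 𝓘(ℝ, E) x x) :=
  ((contDiffOn_coordMetric g x).contDiffAt (extChartAt_target_mem_nhds x)).differentiableAt (by simp)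

/-- The derivative at `x` of the matrix of the metric in the chart at `x`. -/
def metricDeriv (g : Metric E M) (x : M) : E →L[ℝ] E →L[ℝ] E →L[ℝ] ℝ :=
  fderiv ℝ (coordMetric g x) (extChartAt 𝓘(ℝ, E) x x)

lemma hasFDerivAt_coordMetric [FiniteDimensional ℝ E] (g : Metric E M) (x : M) :
    HasFDerivAt (coordMetric g x) (metricDeriv g x) (extChartAt 𝓘(ℝ, E) x x) :=
  (differentiableAt_coordMetric g x).hasFDerivAt

lemma partialBilin_metric [FiniteDimensional ℝ E] (g : Metric E M) (x : M) (u v w : E) :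
    partialBilin (fun z a b => g.inner z a b) x u v w = metricDeriv g x u v w := by
  have h := ((hasFDerivAt_coordMetric g x).clm_apply
    (hasFDerivAt_const v _)).clm_apply (hasFDerivAt_const w _)
  have h' := DFunLike.congr_fun h.fderiv u
  simp only [ContinuousLinearMap.comp_zero, zero_add, ContinuousLinearMap.flip_apply] at h'
  exact h'

lemma metricDeriv_symm [FiniteDimensional ℝ E] (g : Metric E M) (x : M) (u v w : E) :
    metricDeriv g x u v w = metricDeriv g x u w v := by
  rw [← partialBilin_metric, ← partialBilin_metric]
  unfold partialBilin
  simp only [g.symm _ (coordVec x _ v)]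

/-- The derivative at `x` of the matrix of the endomorphism field in the chart at `x`. -/
def endoDeriv (J : (x : M) → TangentSpace 𝓘(ℝ, E) x →L[ℝ] TangentSpace 𝓘(ℝ, E) x) (x : M) :
    E →L[ℝ] E →L[ℝ] E :=
  fderiv ℝ (coordEndo J x) (extChartAt 𝓘(ℝ, E) x x)

lemma hasFDerivAt_coordEndo [FiniteDimensional ℝ E]
    {J : (x : M) → TangentSpace 𝓘(ℝ, E) x →L[ℝ] TangentSpace 𝓘(ℝ, E) x}
    (hJ : IsComplexStructure J) (x : M) :
    HasFDerivAt (coordEndo J x) (endoDeriv J x) (extChartAt 𝓘(ℝ, E) x x) := by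
  refine DifferentiableAt.hasFDerivAt ?_
  have h1 := ((contMDiffAt_hom_bundle _).1 (hJ.smooth x)).2
  have h2 : ContMDiffAt 𝓘(ℝ, E) 𝓘(ℝ, E) ∞ (extChartAt 𝓘(ℝ, E) x).symm (extChartAt 𝓘(ℝ, E) x x) :=
    (contMDiffOn_extChartAt_symm x).contMDiffAt (extChartAt_target_mem_nhds x)
  have h3 := ContMDiffAt.comp_of_eq (y := x) h1 h2 (extChartAt_to_inv x)
  have h4 : DifferentiableAt ℝ _ (extChartAt 𝓘(ℝ, E) x x) :=
    (contMDiffAt_iff_contDiffAt.1 h3).differentiableAt (by simp)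
  refine h4.congr_of_eventuallyEq ?_
  filter_upwards [extChartAt_target_mem_nhds (I := 𝓘(ℝ, E)) x] with y hy
  have hs : (extChartAt 𝓘(ℝ, E) x).symm y ∈ (chartAt E x).source := by
    rw [← extChartAt_source (I := 𝓘(ℝ, E))]
    exact (extChartAt 𝓘(ℝ, E) x).map_target hy
  -- Smoothness in the hom bundle concerns the expression in the trivialization at `x`; near `x`
  -- that expression is conjugation by the chart derivatives, i.e. `coordEndo`.
  have := inTangentCoordinates_eq_mfderiv_comp (I := 𝓘(ℝ, E)) (I' := 𝓘(ℝ, E)) (f := id) (g := id)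
    (ϕ := J) (x₀ := x) (x := (extChartAt 𝓘(ℝ, E) x).symm y) hs hs
  simp only [modelWithCornersSelf_coe, Set.range_id, mfderivWithin_univ, id] at this
  rw [(extChartAt 𝓘(ℝ, E) x).right_inv hy] at this
  exact this.symm

lemma partialEndo_eq [FiniteDimensional ℝ E]
    {J : (x : M) → TangentSpace 𝓘(ℝ, E) x →L[ℝ] TangentSpace 𝓘(ℝ, E) x}
    (hJ : IsComplexStructure J) (x : M) (u v : E) :
    partialEndo J x u v = endoDeriv J x u v := by
  have h := (hasFDerivAt_coordEndo hJ x).clm_apply (hasFDerivAt_const v _)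
  have h' := DFunLike.congr_fun h.fderiv u
  simp only [ContinuousLinearMap.comp_zero, zero_add, ContinuousLinearMap.flip_apply] at h'
  exact h'

lemma partialBilin_fundamentalForm [FiniteDimensional ℝ E] (g : Metric E M)
    {J : (x : M) → TangentSpace 𝓘(ℝ, E) x →L[ℝ] TangentSpace 𝓘(ℝ, E) x}
    (hJ : IsComplexStructure J) (x : M) (u v w : E) :
    partialBilin (fundamentalForm g J) x u v w
      = metricDeriv g x u v (rawEndo J x w) + rawMetric g x v (endoDeriv J x u w) := by
  have h := ((hasFDerivAt_coordMetric g x).clm_apply (hasFDerivAt_const v _)).clm_apply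
      ((hasFDerivAt_coordEndo hJ x).clm_apply (hasFDerivAt_const w _))
  have h' := DFunLike.congr_fun h.fderiv u
  have heq : (fun y : E => fundamentalForm g J _ (coordVec x y v) (coordVec x y w))
      =ᶠ[nhds (extChartAt 𝓘(ℝ, E) x x)] fun y => coordMetric g x y v (coordEndo J x y w) := by
    filter_upwards [extChartAt_target_mem_nhds (I := 𝓘(ℝ, E)) x] with y hy
    simp only [coordMetric, ContinuousLinearMap.bilinearComp_apply, chartSymmDeriv_coordEndo J hy]
    rfl
  simp only [ContinuousLinearMap.comp_zero, zero_add, ContinuousLinearMap.flip_apply,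
    add_apply, coordMetric_self, coordEndo_self, ContinuousLinearMap.comp_apply] at h'
  unfold partialBilin
  rw [heq.fderiv_eq, add_comm]
  exact h'

/-- `e^{-σ} g` in coordinates. -/
lemma partialBilin_conformal [FiniteDimensional ℝ E] (g : Metric E M) (x : M) {σ : M → ℝ}
    {s : E →L[ℝ] ℝ}
    (hσ : HasFDerivAt (fun y => σ ((extChartAt 𝓘(ℝ, E) x).symm y)) s (extChartAt 𝓘(ℝ, E) x x))
    (u v w : E) :
    partialBilin (fun z a b => Real.exp (-σ z) * g.inner z a b) x u v w
      = Real.exp (-σ x) * (metricDeriv g x u v w - s u * rawMetric g x v w) := by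
  have h := hσ.fun_neg.exp.mul (((hasFDerivAt_coordMetric g x).clm_apply
    (hasFDerivAt_const v _)).clm_apply (hasFDerivAt_const w _))
  have h' := DFunLike.congr_fun h.fderiv u
  simp only [ContinuousLinearMap.comp_zero, zero_add, ContinuousLinearMap.flip_apply,
    add_apply, coordMetric_self, extChartAt_to_inv, smul_apply, neg_apply, smul_eq_mul] at h'
  refine Eq.trans h' ?_
  ring

end Coordinates

/-- For a positive definite bilinear form on a finite dimensional space, `dualVector` represents
every linear functional. -/
lemma dualVector_spec {V : Type*} [AddCommGroup V] [Module ℝ V] [FiniteDimensional ℝ V]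
    (B : V →ₗ[ℝ] V →ₗ[ℝ] ℝ) (hB : ∀ v, v ≠ 0 → 0 < B v v) {b : V → V → ℝ} (hb : ∀ v w, b v w = B v w)
    (l : V →ₗ[ℝ] ℝ) {ℓ : V → ℝ} (hl : ∀ w, ℓ w = l w) (w : V) : B (dualVector b ℓ) w = l w := by
  have hinj : Function.Injective B := by
    rw [injective_iff_map_eq_zero]
    intro v hv
    by_contra hne
    exact (hB v hne).ne' (by rw [hv]; rfl)
  have hsurj : Function.Surjective B :=
    (LinearMap.injective_iff_surjective_of_finrank_eq_finrank
      (Subspace.dual_finrank_eq (K := ℝ) (V := V)).symm).1 hinj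
  obtain ⟨c, hc⟩ := hsurj l
  have hex : ∃ c, ∀ w, b c w = ℓ w := ⟨c, fun w => by rw [hb, hl, hc]⟩
  rw [← hb, ← hl]
  exact Classical.epsilon_spec hex w

/-! ### Levi-Civita and Kaehler connections at a point, and the Lee form. -/

section Pointwise

variable {E : Type*} [NormedAddCommGroup E] [NormedSpace ℝ E] [FiniteDimensional ℝ E]
  {M : Type*} [TopologicalSpace M] [ChartedSpace E M] [IsManifold 𝓘(ℝ, E) ∞ M]

/-- The Christoffel symbol of the metric `g` in the chart at `x`, at `x`. -/
def metricChristoffel (g : Metric E M) (x : M) (u v : E) : E :=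
  christoffel (fun z a b => g.inner z a b) x u v

/-- The conformal factor cancels from the Koszul formula, leaving only its logarithmic derivative.
One statement serves both `g` (`c = 1`, `s = 0`) and `e^{-σ}g` (`c = e^{-σ(x)}`, `s = dσ`). -/
lemma christoffel_conformal_spec (g : Metric E M) (x : M) {B : M → E → E → ℝ} {c : ℝ} (hc : 0 < c)
    {s : E →L[ℝ] ℝ} (hB : ∀ u v, B x u v = c * rawMetric g x u v)
    (hd : ∀ u v w : E, partialBilin B x u v w = c * (metricDeriv g x u v w - s u * rawMetric g x v w))
    (u v w : E) :
    rawMetric g x (christoffel B x u v) w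
      = (metricDeriv g x u v w + metricDeriv g x v u w - metricDeriv g x w u v
        - s u * rawMetric g x v w - s v * rawMetric g x u w + s w * rawMetric g x u v) / 2 := by
  let G : E →ₗ[ℝ] E →ₗ[ℝ] ℝ := LinearMap.mk₂ ℝ (fun a b => c * rawMetric g x a b)
    (by intros; simp; ring) (by intros; simp; ring) (by intros; simp; ring) (by intros; simp; ring)
  -- The double `flip` places the free argument in the differentiation slot.
  let l : E →ₗ[ℝ] ℝ := (c / 2) •
    ((metricDeriv g x u v + metricDeriv g x v u - ((metricDeriv g x).flip u).flip v
      - s u • rawMetric g x v - s v • rawMetric g x u + (rawMetric g x u v) • s : E →L[ℝ] ℝ) :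
      E →ₗ[ℝ] ℝ)
  have h := dualVector_spec G (fun a ha => mul_pos hc (rawMetric_pos g x ha)) hB l
    (ℓ := fun w => (partialBilin B x u v w + partialBilin B x v u w - partialBilin B x w u v) / 2)
    (fun w => by
      rw [hd u v w, hd v u w, hd w u v]
      simp only [l, LinearMap.smul_apply, ContinuousLinearMap.coe_coe, add_apply, sub_apply,
        smul_apply, ContinuousLinearMap.flip_apply, smul_eq_mul]
      ring) w
  have h' : c * rawMetric g x (christoffel B x u v) w = l w := h
  rw [← mul_right_inj' hc.ne', h']
  simp only [l, LinearMap.smul_apply, ContinuousLinearMap.coe_coe, add_apply, sub_apply,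
    smul_apply, ContinuousLinearMap.flip_apply, smul_eq_mul]
  ring

lemma metricChristoffel_spec (g : Metric E M) (x : M) (u v w : E) :
    rawMetric g x (metricChristoffel g x u v) w
      = (metricDeriv g x u v w + metricDeriv g x v u w - metricDeriv g x w u v) / 2 := by
  have := christoffel_conformal_spec g x (B := fun z a b => g.inner z a b) (c := 1) (s := 0)
    one_pos (fun u v => (one_mul _).symm)
    (fun u v w => (partialBilin_metric g x u v w).trans
      (by rw [zero_apply, zero_mul, sub_zero, one_mul])) u v w
  simp only [zero_apply, zero_mul, sub_zero, add_zero] at this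
  exact this

omit [FiniteDimensional ℝ E] in
lemma rawMetric_ext (g : Metric E M) (x : M) {a b : E}
    (h : ∀ w, rawMetric g x a w = rawMetric g x b w) : a = b := by
  by_contra hne
  have := rawMetric_pos g x (sub_ne_zero.2 hne)
  rw [rawMetric_symm, map_sub, rawMetric_symm g x _ a, rawMetric_symm g x _ b, h, sub_self] at this
  exact lt_irrefl _ this

lemma metricChristoffel_symm (g : Metric E M) (x : M) (u v : E) :
    metricChristoffel g x u v = metricChristoffel g x v u :=
  rawMetric_ext g x fun w => by
    rw [metricChristoffel_spec, metricChristoffel_spec, metricDeriv_symm g x w u v, add_comm]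

/-- The Levi-Civita connection is metric. -/
lemma metricDeriv_eq (g : Metric E M) (x : M) (u v w : E) :
    metricDeriv g x u v w = rawMetric g x (metricChristoffel g x u v) w
      + rawMetric g x v (metricChristoffel g x u w) := by
  rw [rawMetric_symm g x v, metricChristoffel_spec, metricChristoffel_spec,
    metricDeriv_symm g x u w v, metricDeriv_symm g x w u v, metricDeriv_symm g x v u w]
  ring

/-- A 1-form, with all tangent spaces identified with the model space. -/
def rawForm (α : (x : M) → TangentSpace 𝓘(ℝ, E) x →L[ℝ] ℝ) (x : M) : E →L[ℝ] ℝ :=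
  α x

variable {g : Metric E M} {J : (x : M) → TangentSpace 𝓘(ℝ, E) x →L[ℝ] TangentSpace 𝓘(ℝ, E) x}

omit [FiniteDimensional ℝ E] in
lemma IsLCK.rawEndo_sq (h : IsLCK g J) (x : M) (v : E) : rawEndo J x (rawEndo J x v) = -v :=
  h.complex.sq x v

omit [FiniteDimensional ℝ E] in
lemma IsLCK.rawMetric_rawEndo (h : IsLCK g J) (x : M) (u v : E) :
    rawMetric g x (rawEndo J x u) (rawEndo J x v) = rawMetric g x u v :=
  h.hermitian x u v

omit [FiniteDimensional ℝ E] in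
lemma IsLCK.rawMetric_rawEndo_left (h : IsLCK g J) (x : M) (u v : E) :
    rawMetric g x (rawEndo J x u) v = -rawMetric g x u (rawEndo J x v) := by
  rw [← h.rawMetric_rawEndo x u, h.rawEndo_sq, map_neg, neg_neg]

/-- The Levi-Civita connection of the local Kaehler metric `e^{-σ} g`, with `s = dσ`. -/
lemma IsLCK.exists_kaehler_connection (h : IsLCK g J) (x : M) :
    ∃ (s : E →L[ℝ] ℝ) (Γ : E → E → E),
      (∀ u v w, rawMetric g x (Γ u v) w
        = (metricDeriv g x u v w + metricDeriv g x v u w - metricDeriv g x w u v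
          - s u * rawMetric g x v w - s v * rawMetric g x u w + s w * rawMetric g x u v) / 2) ∧
      ∀ u v, endoDeriv J x u v + Γ u (rawEndo J x v) - rawEndo J x (Γ u v) = 0 := by
  obtain ⟨U, hU, hx, σ, hσ, hcov⟩ := h.locallyConformal x
  have h1 : ContMDiffAt 𝓘(ℝ, E) 𝓘(ℝ, ℝ) ∞ σ x := hσ.contMDiffAt (hU.mem_nhds hx)
  have h2 : ContMDiffAt 𝓘(ℝ, E) 𝓘(ℝ, E) ∞ (extChartAt 𝓘(ℝ, E) x).symm (extChartAt 𝓘(ℝ, E) x x) :=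
    (contMDiffOn_extChartAt_symm x).contMDiffAt (extChartAt_target_mem_nhds x)
  have h3 := ContMDiffAt.comp_of_eq (y := x) h1 h2 (extChartAt_to_inv x)
  have h4 := ((contMDiffAt_iff_contDiffAt.1 h3).differentiableAt (by simp)).hasFDerivAt
  refine ⟨_, fun u v => christoffel (fun z a b => Real.exp (-σ z) * g.inner z a b) x u v,
    fun u v w => christoffel_conformal_spec g x (Real.exp_pos (-σ x)) (fun u v => rfl)
      (partialBilin_conformal g x h4) u v w, fun u v => ?_⟩
  rw [← partialEndo_eq h.complex]
  exact hcov x hx u v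

/-- For `Z` orthogonal to `X` and `JX`, `g((∇_Z J) X, Z) = α(JX) g(Z, Z)`. -/
lemma IsLCK.rawMetric_covDeriv (h : IsLCK g J)
    {α : (x : M) → TangentSpace 𝓘(ℝ, E) x →L[ℝ] ℝ} (hα : IsLeeForm g J α) (x : M) {X Z : E}
    (hX : rawMetric g x X Z = 0) (hJX : rawMetric g x (rawEndo J x X) Z = 0) :
    rawMetric g x (endoDeriv J x Z X + metricChristoffel g x Z (rawEndo J x X)
        - rawEndo J x (metricChristoffel g x Z X)) Z
      = rawForm α x (rawEndo J x X) * rawMetric g x Z Z := by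
  obtain ⟨s, Γ, hΓ, hJ⟩ := h.exists_kaehler_connection x
  have hDJ (u v : E) : endoDeriv J x u v = rawEndo J x (Γ u v) - Γ u (rawEndo J x v) := by
    rw [eq_sub_iff_add_eq, ← sub_eq_zero]
    exact hJ u v
  -- `Γ` is metric for `e^{-σ}g`, so on `g` it leaves the defect `s ⊗ g`.
  have hDG (u v w : E) : metricDeriv g x u v w
      = rawMetric g x (Γ u v) w + rawMetric g x (Γ u w) v + s u * rawMetric g x v w := by
    rw [hΓ, hΓ, metricDeriv_symm g x u w v, metricDeriv_symm g x w u v, metricDeriv_symm g x v u w,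
      rawMetric_symm g x w v]
    ring
  have hdiff (u v w : E) : rawMetric g x (metricChristoffel g x u v) w = rawMetric g x (Γ u v) w
      + (s u * rawMetric g x v w + s v * rawMetric g x u w - s w * rawMetric g x u v) / 2 := by
    rw [metricChristoffel_spec, hΓ]
    ring
  have hΓs (u v : E) : Γ u v = Γ v u := rawMetric_ext g x fun w => by
    rw [hΓ, hΓ, metricDeriv_symm g x w u v, rawMetric_symm g x u v]
    ring
  -- In the cyclic sum the `Γ` terms cancel by symmetry of `Γ`, which leaves `dΩ = s ∧ Ω`.
  have hO (u v w : E) : partialBilin (fundamentalForm g J) x u v w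
      = rawMetric g x (Γ u v) (rawEndo J x w) - rawMetric g x (Γ u w) (rawEndo J x v)
        + s u * rawMetric g x v (rawEndo J x w) := by
    rw [partialBilin_fundamentalForm g h.complex, hDG, hDJ, map_sub,
      ← neg_eq_iff_eq_neg.2 (h.rawMetric_rawEndo_left x v (Γ u w)),
      rawMetric_symm g x (rawEndo J x v) (Γ u w), rawMetric_symm g x v (Γ u (rawEndo J x w))]
    ring
  have hZJZ : rawMetric g x Z (rawEndo J x Z) = 0 := by
    have := h.rawMetric_rawEndo_left x Z Z
    rw [rawMetric_symm] at this
    linarith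
  have hXJZ : rawMetric g x X (rawEndo J x Z) = 0 := by
    rw [← neg_eq_zero, ← h.rawMetric_rawEndo_left, hJX]
  have hlee : 2 * rawForm α x (rawEndo J x X) * rawMetric g x Z Z
      = s (rawEndo J x X) * rawMetric g x Z Z := by
    -- On `(JX, Z, JZ)` only `Ω(Z, JZ) = -|Z|²` survives; the other two values of `Ω` vanish by
    -- orthogonality, which isolates the coefficient of `JX`.
    have hd := hα.dOmega x (rawEndo J x X) Z (rawEndo J x Z)
    rw [hO, hO, hO] at hd
    change _ = 2 * (rawForm α x (rawEndo J x X) * rawMetric g x Z (rawEndo J x (rawEndo J x Z))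
      + rawForm α x Z * rawMetric g x (rawEndo J x Z) (rawEndo J x (rawEndo J x X))
      + rawForm α x (rawEndo J x Z) * rawMetric g x (rawEndo J x X) (rawEndo J x Z)) at hd
    rw [hΓs Z (rawEndo J x X), hΓs (rawEndo J x Z) (rawEndo J x X), hΓs (rawEndo J x Z) Z] at hd
    simp only [h.rawEndo_sq, map_neg, h.rawMetric_rawEndo, hX,
      rawMetric_symm g x (rawEndo J x Z) X, hXJZ] at hd
    linarith
  -- Subtracting `∇*J = 0` leaves only the difference tensor `∇ - ∇*`, given by `hdiff`.
  have hsplit : endoDeriv J x Z X + metricChristoffel g x Z (rawEndo J x X)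
        - rawEndo J x (metricChristoffel g x Z X)
      = rawEndo J x (Γ Z X - metricChristoffel g x Z X)
        - (Γ Z (rawEndo J x X) - metricChristoffel g x Z (rawEndo J x X)) := by
    rw [hDJ, map_sub]
    abel
  rw [hsplit, map_sub, sub_apply, h.rawMetric_rawEndo_left, map_sub, map_sub, sub_apply, sub_apply,
    hdiff, hdiff, hZJZ, hXJZ, hJX, rawMetric_symm g x Z X, rawMetric_symm g x Z (rawEndo J x X),
    hX, hJX]
  linarith

end Pointwise

/-! ### Derivatives along a map from a product, in product charts. -/

section ProductCharts

variable {E : Type*} [NormedAddCommGroup E] [NormedSpace ℝ E]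
  {M : Type*} [TopologicalSpace M] [ChartedSpace E M]
  {E₁ : Type*} [NormedAddCommGroup E₁] [NormedSpace ℝ E₁]
  {N₁ : Type*} [TopologicalSpace N₁] [ChartedSpace E₁ N₁]
  {E₂ : Type*} [NormedAddCommGroup E₂] [NormedSpace ℝ E₂]
  {N₂ : Type*} [TopologicalSpace N₂] [ChartedSpace E₂ N₂]

/-- The coordinates of `p` in the product chart at `p`. -/
def prodCoord (p : N₁ × N₂) : E₁ × E₂ :=
  (extChartAt 𝓘(ℝ, E₁) p.1 p.1, extChartAt 𝓘(ℝ, E₂) p.2 p.2)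

/-- The inverse of the product chart at `p`. -/
def prodChartSymm (p : N₁ × N₂) (y : E₁ × E₂) : N₁ × N₂ :=
  ((extChartAt 𝓘(ℝ, E₁) p.1).symm y.1, (extChartAt 𝓘(ℝ, E₂) p.2).symm y.2)

/-- The derivative of the inverse of the product chart at `p`. -/
def prodChartSymmDeriv (p : N₁ × N₂) (y : E₁ × E₂) : E₁ × E₂ →L[ℝ] E₁ × E₂ :=
  (chartSymmDeriv p.1 y.1).prodMap (chartSymmDeriv p.2 y.2)

/-- The map `φ` in the charts at `p` and `φ p`. -/
def coordMap (E : Type*) [NormedAddCommGroup E] [NormedSpace ℝ E] {M : Type*} [TopologicalSpace M]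
    [ChartedSpace E M] (φ : N₁ × N₂ → M) (p : N₁ × N₂) (y : E₁ × E₂) : E :=
  extChartAt 𝓘(ℝ, E) (φ p) (φ (prodChartSymm p y))

/-- The derivative of `φ` at `q`, as a linear map between the model spaces. -/
def rawDeriv (E E₁ E₂ : Type*) [NormedAddCommGroup E] [NormedSpace ℝ E]
    [NormedAddCommGroup E₁] [NormedSpace ℝ E₁] [NormedAddCommGroup E₂] [NormedSpace ℝ E₂]
    {M N₁ N₂ : Type*} [TopologicalSpace M] [ChartedSpace E M] [TopologicalSpace N₁]
    [ChartedSpace E₁ N₁] [TopologicalSpace N₂] [ChartedSpace E₂ N₂]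
    (φ : N₁ × N₂ → M) (q : N₁ × N₂) : E₁ × E₂ →L[ℝ] E :=
  mfderiv (𝓘(ℝ, E₁).prod 𝓘(ℝ, E₂)) 𝓘(ℝ, E) φ q

lemma extChartAt_prod_self (p : N₁ × N₂) :
    extChartAt (𝓘(ℝ, E₁).prod 𝓘(ℝ, E₂)) p p = (prodCoord p : E₁ × E₂) := by
  rw [extChartAt_prod]
  rfl

lemma writtenInExtChartAt_eq_coordMap (φ : N₁ × N₂ → M) (p : N₁ × N₂) :
    writtenInExtChartAt (𝓘(ℝ, E₁).prod 𝓘(ℝ, E₂)) 𝓘(ℝ, E) p φ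
      = (coordMap E φ p : E₁ × E₂ → E) := by
  unfold writtenInExtChartAt
  rw [extChartAt_prod]
  rfl

lemma prodChartSymm_prodCoord (p : N₁ × N₂) : prodChartSymm p (prodCoord p : E₁ × E₂) = p := by
  simp only [prodChartSymm, prodCoord, extChartAt_to_inv]

lemma coordMap_prodCoord (φ : N₁ × N₂ → M) (p : N₁ × N₂) :
    coordMap E φ p (prodCoord p : E₁ × E₂) = extChartAt 𝓘(ℝ, E) (φ p) (φ p) := by
  rw [coordMap, prodChartSymm_prodCoord]

lemma eventually_mem_prodChart (p : N₁ × N₂) : ∀ᶠ y : E₁ × E₂ in nhds (prodCoord p),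
    y.1 ∈ (extChartAt 𝓘(ℝ, E₁) p.1).target ∧ y.2 ∈ (extChartAt 𝓘(ℝ, E₂) p.2).target :=
  prod_mem_nhds (extChartAt_target_mem_nhds (I := 𝓘(ℝ, E₁)) p.1)
    (extChartAt_target_mem_nhds (I := 𝓘(ℝ, E₂)) p.2)

lemma contDiffAt_coordMap {φ : N₁ × N₂ → M}
    (hφ : ContMDiff (𝓘(ℝ, E₁).prod 𝓘(ℝ, E₂)) 𝓘(ℝ, E) ∞ φ) (p : N₁ × N₂) :
    ContDiffAt ℝ ∞ (coordMap E φ p) (prodCoord p : E₁ × E₂) := by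
  have h := (contMDiffAt_iff.1 (hφ p)).2
  rw [ModelWithCorners.range_eq_univ, contDiffWithinAt_univ] at h
  rw [← writtenInExtChartAt_eq_coordMap, ← extChartAt_prod_self]
  exact h

lemma rawDeriv_eq_fderiv {φ : N₁ × N₂ → M}
    (hφ : ContMDiff (𝓘(ℝ, E₁).prod 𝓘(ℝ, E₂)) 𝓘(ℝ, E) ∞ φ) (p : N₁ × N₂) :
    rawDeriv E E₁ E₂ φ p = fderiv ℝ (coordMap E φ p) (prodCoord p : E₁ × E₂) := by
  have h := ((hφ p).mdifferentiableAt (by simp)).mfderiv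
  rw [ModelWithCorners.range_eq_univ, fderivWithin_univ, writtenInExtChartAt_eq_coordMap,
    extChartAt_prod_self] at h
  exact h

lemma hasFDerivAt_coordMap {φ : N₁ × N₂ → M}
    (hφ : ContMDiff (𝓘(ℝ, E₁).prod 𝓘(ℝ, E₂)) 𝓘(ℝ, E) ∞ φ) (p : N₁ × N₂) :
    HasFDerivAt (coordMap E φ p) (rawDeriv E E₁ E₂ φ p) (prodCoord p : E₁ × E₂) := by
  rw [rawDeriv_eq_fderiv hφ]
  exact ((contDiffAt_coordMap hφ p).differentiableAt (by simp)).hasFDerivAt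

lemma hasFDerivAt_fderiv_coordMap {φ : N₁ × N₂ → M}
    (hφ : ContMDiff (𝓘(ℝ, E₁).prod 𝓘(ℝ, E₂)) 𝓘(ℝ, E) ∞ φ) (p : N₁ × N₂) :
    HasFDerivAt (fderiv ℝ (coordMap E φ p)) (fderiv ℝ (fderiv ℝ (coordMap E φ p)) (prodCoord p))
      (prodCoord p : E₁ × E₂) :=
  (((contDiffAt_coordMap hφ p).fderiv_right (m := ∞) (by simp)).differentiableAt
    (by simp)).hasFDerivAt

variable [IsManifold 𝓘(ℝ, E) ∞ M]

/-- `∇̃_u (φ_* v)` at `p`, in coordinates. -/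
def rawAmbientDeriv (g : Metric E M) (φ : N₁ × N₂ → M) (p : N₁ × N₂) (u v : E₁ × E₂) : E :=
  fderiv ℝ (fderiv ℝ (coordMap E φ p)) (prodCoord p) u v
    + metricChristoffel g (φ p) (rawDeriv E E₁ E₂ φ p u) (rawDeriv E E₁ E₂ φ p v)

lemma ambientDeriv_eq (g : Metric E M) (φ : N₁ × N₂ → M) (p : N₁ × N₂) (u v : E₁ × E₂) :
    ambientDeriv (𝓘(ℝ, E₁).prod 𝓘(ℝ, E₂)) g φ p u v = rawAmbientDeriv g φ p u v := by
  unfold ambientDeriv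
  rw [writtenInExtChartAt_eq_coordMap, extChartAt_prod_self]
  rfl

/-- Coordinate fields commute: the second derivative of `φ` is symmetric and the connection is
torsion-free. -/
lemma rawAmbientDeriv_symm [FiniteDimensional ℝ E] (g : Metric E M) {φ : N₁ × N₂ → M}
    (hφ : ContMDiff (𝓘(ℝ, E₁).prod 𝓘(ℝ, E₂)) 𝓘(ℝ, E) ∞ φ) (p : N₁ × N₂) (u v : E₁ × E₂) :
    rawAmbientDeriv g φ p u v = rawAmbientDeriv g φ p v u := by
  rw [rawAmbientDeriv, rawAmbientDeriv, metricChristoffel_symm,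
    ((contDiffAt_coordMap hφ p).isSymmSndFDerivAt
      (by rw [minSmoothness_of_isRCLikeNormedField]; exact WithTop.coe_le_coe.2 (le_top : (2 : ℕ∞) ≤ ⊤))).eq]

lemma hasFDerivAt_coordMetric_coordMap [FiniteDimensional ℝ E] (g : Metric E M) {φ : N₁ × N₂ → M}
    (hφ : ContMDiff (𝓘(ℝ, E₁).prod 𝓘(ℝ, E₂)) 𝓘(ℝ, E) ∞ φ) (p : N₁ × N₂) :
    HasFDerivAt (fun y : E₁ × E₂ => coordMetric g (φ p) (coordMap E φ p y))
      (metricDeriv g (φ p) ∘L rawDeriv E E₁ E₂ φ p) (prodCoord p) :=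
  HasFDerivAt.comp (g := coordMetric g (φ p)) _
    (by rw [coordMap_prodCoord]; exact hasFDerivAt_coordMetric g (φ p)) (hasFDerivAt_coordMap hφ p)

/-- Metric compatibility of the connection along `φ`. -/
lemma fderiv_induced [FiniteDimensional ℝ E] (g : Metric E M) {φ : N₁ × N₂ → M}
    (hφ : ContMDiff (𝓘(ℝ, E₁).prod 𝓘(ℝ, E₂)) 𝓘(ℝ, E) ∞ φ) (p : N₁ × N₂) (w u v : E₁ × E₂) :
    fderiv ℝ (fun y => coordMetric g (φ p) (coordMap E φ p y) (fderiv ℝ (coordMap E φ p) y u)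
        (fderiv ℝ (coordMap E φ p) y v)) (prodCoord p) w
      = rawMetric g (φ p) (rawAmbientDeriv g φ p w u) (rawDeriv E E₁ E₂ φ p v)
        + rawMetric g (φ p) (rawDeriv E E₁ E₂ φ p u) (rawAmbientDeriv g φ p w v) := by
  have h := ((hasFDerivAt_coordMetric_coordMap g hφ p).clm_apply
    ((hasFDerivAt_fderiv_coordMap hφ p).clm_apply (hasFDerivAt_const u _))).clm_apply
      ((hasFDerivAt_fderiv_coordMap hφ p).clm_apply (hasFDerivAt_const v _))
  rw [h.fderiv]
  simp only [ContinuousLinearMap.comp_zero, zero_add, ContinuousLinearMap.flip_apply,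
    add_apply, coordMap_prodCoord, coordMetric_self, ContinuousLinearMap.comp_apply,
    ← rawDeriv_eq_fderiv hφ, metricDeriv_eq, rawAmbientDeriv, map_add]
  ring

/-- The Leibniz rule for `g(Ju, v)` along `φ`. Adding and subtracting `JΓ(w, u)` turns the
derivative of the matrix of `J` into `(∇_w J)u`. -/
lemma fderiv_rawEndo [FiniteDimensional ℝ E] (g : Metric E M) {φ : N₁ × N₂ → M}
    {J : (x : M) → TangentSpace 𝓘(ℝ, E) x →L[ℝ] TangentSpace 𝓘(ℝ, E) x} (hJ : IsComplexStructure J)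
    (hφ : ContMDiff (𝓘(ℝ, E₁).prod 𝓘(ℝ, E₂)) 𝓘(ℝ, E) ∞ φ) (p : N₁ × N₂) (w u v : E₁ × E₂) :
    fderiv ℝ (fun y => coordMetric g (φ p) (coordMap E φ p y)
        (coordEndo J (φ p) (coordMap E φ p y) (fderiv ℝ (coordMap E φ p) y u))
        (fderiv ℝ (coordMap E φ p) y v)) (prodCoord p) w
      = rawMetric g (φ p) (endoDeriv J (φ p) (rawDeriv E E₁ E₂ φ p w) (rawDeriv E E₁ E₂ φ p u)
          + metricChristoffel g (φ p) (rawDeriv E E₁ E₂ φ p w)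
            (rawEndo J (φ p) (rawDeriv E E₁ E₂ φ p u))
          - rawEndo J (φ p) (metricChristoffel g (φ p) (rawDeriv E E₁ E₂ φ p w)
            (rawDeriv E E₁ E₂ φ p u))) (rawDeriv E E₁ E₂ φ p v)
        + rawMetric g (φ p) (rawEndo J (φ p) (rawAmbientDeriv g φ p w u)) (rawDeriv E E₁ E₂ φ p v)
        + rawMetric g (φ p) (rawEndo J (φ p) (rawDeriv E E₁ E₂ φ p u))
          (rawAmbientDeriv g φ p w v) := by
  have hJ' : HasFDerivAt (fun y : E₁ × E₂ => coordEndo J (φ p) (coordMap E φ p y))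
      (endoDeriv J (φ p) ∘L rawDeriv E E₁ E₂ φ p) (prodCoord p) :=
    HasFDerivAt.comp (g := coordEndo J (φ p)) _
      (by rw [coordMap_prodCoord]; exact hasFDerivAt_coordEndo hJ (φ p)) (hasFDerivAt_coordMap hφ p)
  have h := ((hasFDerivAt_coordMetric_coordMap g hφ p).clm_apply (hJ'.clm_apply
    ((hasFDerivAt_fderiv_coordMap hφ p).clm_apply (hasFDerivAt_const u _)))).clm_apply
      ((hasFDerivAt_fderiv_coordMap hφ p).clm_apply (hasFDerivAt_const v _))
  rw [h.fderiv]
  simp only [ContinuousLinearMap.comp_zero, zero_add, ContinuousLinearMap.flip_apply,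
    add_apply, sub_apply, coordMap_prodCoord, coordMetric_self, coordEndo_self,
    ContinuousLinearMap.comp_apply,
    ← rawDeriv_eq_fderiv hφ, metricDeriv_eq, rawAmbientDeriv, map_add, map_sub]
  ring

variable [IsManifold 𝓘(ℝ, E₁) ∞ N₁] [IsManifold 𝓘(ℝ, E₂) ∞ N₂]

lemma hasMFDerivAt_prodChartSymm (p : N₁ × N₂) {y : E₁ × E₂}
    (h1 : y.1 ∈ (extChartAt 𝓘(ℝ, E₁) p.1).target) (h2 : y.2 ∈ (extChartAt 𝓘(ℝ, E₂) p.2).target) :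
    HasMFDerivAt 𝓘(ℝ, E₁ × E₂) (𝓘(ℝ, E₁).prod 𝓘(ℝ, E₂)) (prodChartSymm p) y
      (prodChartSymmDeriv p y) :=
  ((hasMFDerivAt_extChartAt_symm h1).comp y
    (hasFDerivAt_fst (𝕜 := ℝ) (E := E₁) (F := E₂)).hasMFDerivAt).prodMk
  ((hasMFDerivAt_extChartAt_symm h2).comp y
    (hasFDerivAt_snd (𝕜 := ℝ) (E := E₁) (F := E₂)).hasMFDerivAt)

omit [IsManifold 𝓘(ℝ, E) ∞ M] in
lemma eventually_mem_source {φ : N₁ × N₂ → M}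
    (hφ : ContMDiff (𝓘(ℝ, E₁).prod 𝓘(ℝ, E₂)) 𝓘(ℝ, E) ∞ φ) (p : N₁ × N₂) :
    ∀ᶠ y : E₁ × E₂ in nhds (prodCoord p),
      φ (prodChartSymm p y) ∈ (extChartAt 𝓘(ℝ, E) (φ p)).source := by
  have h := eventually_mem_prodChart (E₁ := E₁) (E₂ := E₂) p
  have hc : ContinuousAt (prodChartSymm p) (prodCoord p : E₁ × E₂) :=
    (hasMFDerivAt_prodChartSymm p h.self_of_nhds.1 h.self_of_nhds.2).continuousAt
  refine (hφ.continuous.continuousAt.comp hc).preimage_mem_nhds ?_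
  rw [Function.comp_apply, prodChartSymm_prodCoord]
  exact extChartAt_source_mem_nhds (φ p)

/-- The chain rule between `φ` and its expression in charts. -/
lemma eventually_rawDeriv_chart {φ : N₁ × N₂ → M}
    (hφ : ContMDiff (𝓘(ℝ, E₁).prod 𝓘(ℝ, E₂)) 𝓘(ℝ, E) ∞ φ) (p : N₁ × N₂) :
    ∀ᶠ y : E₁ × E₂ in nhds (prodCoord p),
      coordMap E φ p y ∈ (extChartAt 𝓘(ℝ, E) (φ p)).target ∧
      (extChartAt 𝓘(ℝ, E) (φ p)).symm (coordMap E φ p y) = φ (prodChartSymm p y) ∧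
      ∀ u, rawDeriv E E₁ E₂ φ (prodChartSymm p y) (prodChartSymmDeriv p y u)
        = chartSymmDeriv (φ p) (coordMap E φ p y) (fderiv ℝ (coordMap E φ p) y u) := by
  filter_upwards [eventually_mem_prodChart p, (eventually_mem_source hφ p).eventually_nhds,
    ((contDiffAt_coordMap hφ p).of_le (m := 1) (by simp)).eventually (by simp)] with y hy hs hd
  have ht : coordMap E φ p y ∈ (extChartAt 𝓘(ℝ, E) (φ p)).target :=
    (extChartAt 𝓘(ℝ, E) (φ p)).map_source hs.self_of_nhds
  refine ⟨ht, (extChartAt 𝓘(ℝ, E) (φ p)).left_inv hs.self_of_nhds, fun u => ?_⟩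
  have h1 := (((hφ (prodChartSymm p y)).mdifferentiableAt (by simp)).hasMFDerivAt).comp y
    (hasMFDerivAt_prodChartSymm p hy.1 hy.2)
  have h2 := (hasMFDerivAt_extChartAt_symm ht).comp y
    (hd.differentiableAt (by simp)).hasFDerivAt.hasMFDerivAt
  -- Equality of derivatives at `y` needs agreement near `y`, hence the `eventually_nhds` form of
  -- the source condition.
  have heq : φ ∘ prodChartSymm p =ᶠ[nhds y]
      (extChartAt 𝓘(ℝ, E) (φ p)).symm ∘ coordMap E φ p := by
    filter_upwards [hs] with z hz
    exact ((extChartAt 𝓘(ℝ, E) (φ p)).left_inv hz).symm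
  have h3 : mfderiv 𝓘(ℝ, E₁ × E₂) 𝓘(ℝ, E) (φ ∘ prodChartSymm p) y
    = (mfderiv 𝓘(ℝ, E₁ × E₂) 𝓘(ℝ, E) ((extChartAt 𝓘(ℝ, E) (φ p)).symm ∘ coordMap E φ p) y : _) :=
    heq.mfderiv_eq
  exact DFunLike.congr_fun (h1.mfderiv.symm.trans (h3.trans h2.mfderiv)) u

end ProductCharts

/-! ### The warped metric, its connection and the Lee form. -/

section WarpedProducts

variable {E : Type*} [NormedAddCommGroup E] [NormedSpace ℝ E]
  {M : Type*} [TopologicalSpace M] [ChartedSpace E M] [IsManifold 𝓘(ℝ, E) ∞ M]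
  {E₁ : Type*} [NormedAddCommGroup E₁] [NormedSpace ℝ E₁]
  {N₁ : Type*} [TopologicalSpace N₁] [ChartedSpace E₁ N₁] [IsManifold 𝓘(ℝ, E₁) ∞ N₁]
  {E₂ : Type*} [NormedAddCommGroup E₂] [NormedSpace ℝ E₂]
  {N₂ : Type*} [TopologicalSpace N₂] [ChartedSpace E₂ N₂] [IsManifold 𝓘(ℝ, E₂) ∞ N₂]
  {g : Metric E M} {J : (x : M) → TangentSpace 𝓘(ℝ, E) x →L[ℝ] TangentSpace 𝓘(ℝ, E) x}
  {g₁ : Metric E₁ N₁} {g₂ : Metric E₂ N₂} {f : N₁ → ℝ} {φ : N₁ × N₂ → M} {θ : N₁ × N₂ → ℝ}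

omit [IsManifold 𝓘(ℝ, E₁) ∞ N₁] [IsManifold 𝓘(ℝ, E₂) ∞ N₂] in
lemma mem_firstDist_iff (p : N₁ × N₂) (u : E₁ × E₂) : u ∈ firstDist E₁ E₂ p ↔ u.2 = 0 := by
  unfold firstDist
  rw [mfderiv_snd]
  rfl

omit [IsManifold 𝓘(ℝ, E₁) ∞ N₁] [IsManifold 𝓘(ℝ, E₂) ∞ N₂] in
lemma mem_secondDist_iff (p : N₁ × N₂) (u : E₁ × E₂) : u ∈ secondDist E₁ E₂ p ↔ u.1 = 0 := by
  unfold secondDist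
  rw [mfderiv_fst]
  rfl

namespace IsSemiSlantWarpedProduct

lemma rawMetric_rawDeriv (hφ : IsSemiSlantWarpedProduct g J g₁ g₂ f φ θ) (q : N₁ × N₂)
    (u v : E₁ × E₂) :
    rawMetric g (φ q) (rawDeriv E E₁ E₂ φ q u) (rawDeriv E E₁ E₂ φ q v)
      = rawMetric g₁ q.1 u.1 v.1 + f q.1 ^ 2 * rawMetric g₂ q.2 u.2 v.2 := by
  have h := hφ.isometric q u v
  unfold warpedMetric at h
  rw [mfderiv_fst, mfderiv_snd] at h
  exact h

/-- The holomorphic distribution is invariant under `J`. -/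
lemma exists_rawEndo_eq (hφ : IsSemiSlantWarpedProduct g J g₁ g₂ f φ θ) (q : N₁ × N₂) (x : E₁) :
    ∃ x' : E₁, rawEndo J (φ q) (rawDeriv E E₁ E₂ φ q (x, 0)) = rawDeriv E E₁ E₂ φ q (x', 0) := by
  have hmem := Submodule.mem_map_of_mem (f := (J (φ q)).toLinearMap) (Submodule.mem_map_of_mem
    (f := (mfderiv (𝓘(ℝ, E₁).prod 𝓘(ℝ, E₂)) 𝓘(ℝ, E) φ q).toLinearMap)
      ((mem_firstDist_iff q (x, (0 : E₂))).2 rfl))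
  rw [hφ.semiSlant.holomorphic q] at hmem
  obtain ⟨⟨a, b⟩, hab, h⟩ := Submodule.mem_map.1 hmem
  obtain rfl : b = 0 := (mem_firstDist_iff q (a, b)).1 hab
  exact ⟨a, h.symm⟩

lemma rawMetric_rawEndo_eq_zero (hφ : IsSemiSlantWarpedProduct g J g₁ g₂ f φ θ) (q : N₁ × N₂)
    (x : E₁) (z : E₂) :
    rawMetric g (φ q) (rawEndo J (φ q) (rawDeriv E E₁ E₂ φ q (x, 0)))
      (rawDeriv E E₁ E₂ φ q (0, z)) = 0 := by
  obtain ⟨x', hx'⟩ := hφ.exists_rawEndo_eq q x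
  rw [hx', hφ.rawMetric_rawDeriv]
  simp

/-- The induced metric equals the warped one, which is positive definite because `f > 0`; so the
vector chosen in `dualVector` is a genuine orthogonal projection. -/
lemma rawMetric_tangentialPart [FiniteDimensional ℝ E₁] [FiniteDimensional ℝ E₂]
    (hφ : IsSemiSlantWarpedProduct g J g₁ g₂ f φ θ) (q : N₁ × N₂) (ξ : E) (w : E₁ × E₂) :
    rawMetric g (φ q)
      (rawDeriv E E₁ E₂ φ q (tangentialPart (𝓘(ℝ, E₁).prod 𝓘(ℝ, E₂)) g φ q ξ))
      (rawDeriv E E₁ E₂ φ q w) = rawMetric g (φ q) ξ (rawDeriv E E₁ E₂ φ q w) := by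
  let G : E₁ × E₂ →ₗ[ℝ] E₁ × E₂ →ₗ[ℝ] ℝ := LinearMap.mk₂ ℝ
    (fun a b => rawMetric g (φ q) (rawDeriv E E₁ E₂ φ q a) (rawDeriv E E₁ E₂ φ q b))
    (by intros; simp) (by intros; simp) (by intros; simp) (by intros; simp)
  have hG (v : E₁ × E₂) (hv : v ≠ 0) : 0 < G v v := by
    change 0 < rawMetric g (φ q) (rawDeriv E E₁ E₂ φ q v) (rawDeriv E E₁ E₂ φ q v)
    rw [hφ.rawMetric_rawDeriv]
    have hf := pow_pos (hφ.warping_pos q.1) 2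
    by_cases h1 : v.1 = 0
    · have h2 : v.2 ≠ 0 := fun h2 => hv (Prod.ext h1 h2)
      rw [h1, map_zero, zero_add]
      exact mul_pos hf (rawMetric_pos g₂ q.2 h2)
    · by_cases h2 : v.2 = 0
      · rw [h2, map_zero, mul_zero, add_zero]
        exact rawMetric_pos g₁ q.1 h1
      · exact add_pos (rawMetric_pos g₁ q.1 h1) (mul_pos hf (rawMetric_pos g₂ q.2 h2))
  exact dualVector_spec G hG (fun v w => rfl)
    ((rawMetric g (φ q) ξ ∘L rawDeriv E E₁ E₂ φ q : E₁ × E₂ →L[ℝ] ℝ) : E₁ × E₂ →ₗ[ℝ] ℝ)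
    (fun w => rfl) w

/-- The normal component is orthogonal to the tangent space. -/
lemma rawMetric_normalPart [FiniteDimensional ℝ E₁] [FiniteDimensional ℝ E₂]
    (hφ : IsSemiSlantWarpedProduct g J g₁ g₂ f φ θ) (q : N₁ × N₂) (ξ : E) (w : E₁ × E₂) :
    rawMetric g (φ q) (normalPart (𝓘(ℝ, E₁).prod 𝓘(ℝ, E₂)) g φ q ξ)
      (rawDeriv E E₁ E₂ φ q w) = 0 := by
  change rawMetric g (φ q) (ξ - rawDeriv E E₁ E₂ φ q
    (tangentialPart (𝓘(ℝ, E₁).prod 𝓘(ℝ, E₂)) g φ q ξ)) (rawDeriv E E₁ E₂ φ q w) = 0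
  rw [map_sub, sub_apply, hφ.rawMetric_tangentialPart, sub_self]

lemma eventually_isometric (hφ : IsSemiSlantWarpedProduct g J g₁ g₂ f φ θ) (p : N₁ × N₂) :
    ∀ᶠ y : E₁ × E₂ in nhds (prodCoord p), ∀ u v,
      coordMetric g (φ p) (coordMap E φ p y) (fderiv ℝ (coordMap E φ p) y u)
          (fderiv ℝ (coordMap E φ p) y v)
        = coordMetric g₁ p.1 y.1 u.1 v.1
          + f ((extChartAt 𝓘(ℝ, E₁) p.1).symm y.1) ^ 2 * coordMetric g₂ p.2 y.2 u.2 v.2 := by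
  filter_upwards [eventually_rawDeriv_chart hφ.smooth p] with y ⟨_, hq, hd⟩ u v
  rw [coordMetric, ContinuousLinearMap.bilinearComp_apply, ← hd, ← hd, hq, hφ.rawMetric_rawDeriv]
  rfl

/-- This is the identity `g(JX, Z) = 0` that is differentiated in `leeForm_eq`, so it is needed on a
neighbourhood. The inverse product chart preserves the two factors, so coordinate fields stay in `𝔇`
and `𝔇^θ`. -/
lemma eventually_rawEndo_orthogonal (hφ : IsSemiSlantWarpedProduct g J g₁ g₂ f φ θ)
    (p : N₁ × N₂) (x : E₁) (z : E₂) :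
    ∀ᶠ y : E₁ × E₂ in nhds (prodCoord p),
      coordMetric g (φ p) (coordMap E φ p y)
        (coordEndo J (φ p) (coordMap E φ p y) (fderiv ℝ (coordMap E φ p) y (x, 0)))
        (fderiv ℝ (coordMap E φ p) y (0, z)) = 0 := by
  filter_upwards [eventually_rawDeriv_chart hφ.smooth p] with y ⟨ht, hq, hd⟩
  rw [coordMetric, ContinuousLinearMap.bilinearComp_apply, chartSymmDeriv_coordEndo J ht,
    ← hd, ← hd, hq]
  have h1 : prodChartSymmDeriv p y (x, (0 : E₂)) = (chartSymmDeriv p.1 y.1 x, 0) := by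
    simp [prodChartSymmDeriv]
  have h2 : prodChartSymmDeriv p y ((0 : E₁), z) = (0, chartSymmDeriv p.2 y.2 z) := by
    simp [prodChartSymmDeriv]
  rw [h1, h2, hφ.rawMetric_rawEndo_eq_zero]

/-- The derivative of the warping function, as a functional on the model space. -/
def warpingDeriv (E₁ : Type*) [NormedAddCommGroup E₁] [NormedSpace ℝ E₁] {N₁ : Type*}
    [TopologicalSpace N₁] [ChartedSpace E₁ N₁] (f : N₁ → ℝ) (x : N₁) : E₁ →L[ℝ] ℝ :=
  mfderiv 𝓘(ℝ, E₁) 𝓘(ℝ, ℝ) f x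

lemma hasMFDerivAt_warping (hφ : IsSemiSlantWarpedProduct g J g₁ g₂ f φ θ) (x : N₁) :
    HasMFDerivAt 𝓘(ℝ, E₁) 𝓘(ℝ, ℝ) f x (warpingDeriv E₁ f x) :=
  ((hφ.warping_smooth x).mdifferentiableAt (by simp)).hasMFDerivAt

lemma hasFDerivAt_warping (hφ : IsSemiSlantWarpedProduct g J g₁ g₂ f φ θ) (x : N₁) :
    HasFDerivAt (fun y => f ((extChartAt 𝓘(ℝ, E₁) x).symm y)) (warpingDeriv E₁ f x)
      (extChartAt 𝓘(ℝ, E₁) x x) := by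
  have h1 := hasMFDerivAt_extChartAt_symm (mem_extChartAt_target (I := 𝓘(ℝ, E₁)) x)
  rw [chartSymmDeriv_self] at h1
  have h2 := hφ.hasMFDerivAt_warping ((extChartAt 𝓘(ℝ, E₁) x).symm (extChartAt 𝓘(ℝ, E₁) x x))
  have h3 := (h2.comp _ h1).hasFDerivAt
  rw [extChartAt_to_inv] at h3
  exact h3

lemma mfderiv_log_warping (hφ : IsSemiSlantWarpedProduct g J g₁ g₂ f φ θ) (p : N₁ × N₂)
    (u : E₁ × E₂) :
    mfderiv (𝓘(ℝ, E₁).prod 𝓘(ℝ, E₂)) 𝓘(ℝ, ℝ) (fun q : N₁ × N₂ => Real.log (f q.1)) p u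
      = warpingDeriv E₁ f p.1 u.1 / f p.1 := by
  have h1 : HasMFDerivAt (𝓘(ℝ, E₁).prod 𝓘(ℝ, E₂)) 𝓘(ℝ, E₁) (Prod.fst : N₁ × N₂ → N₁) p _ :=
    hasMFDerivAt_fst p
  have h2 := ((Real.hasDerivAt_log (hφ.warping_pos p.1).ne').hasFDerivAt.hasMFDerivAt).comp p
    ((hφ.hasMFDerivAt_warping p.1).comp p h1)
  refine (DFunLike.congr_fun h2.mfderiv u).trans ?_
  change warpingDeriv E₁ f p.1 u.1 * (f p.1)⁻¹ = _
  rw [div_eq_mul_inv]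

variable [FiniteDimensional ℝ E] [FiniteDimensional ℝ E₁] [FiniteDimensional ℝ E₂]

/-- The first derivatives of the warped product metric. -/
lemma rawMetric_rawAmbientDeriv_add (hφ : IsSemiSlantWarpedProduct g J g₁ g₂ f φ θ)
    (p : N₁ × N₂) (w u v : E₁ × E₂) :
    rawMetric g (φ p) (rawAmbientDeriv g φ p w u) (rawDeriv E E₁ E₂ φ p v)
        + rawMetric g (φ p) (rawDeriv E E₁ E₂ φ p u) (rawAmbientDeriv g φ p w v)
      = metricDeriv g₁ p.1 w.1 u.1 v.1
        + (2 * f p.1 * warpingDeriv E₁ f p.1 w.1 * rawMetric g₂ p.2 u.2 v.2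
          + f p.1 ^ 2 * metricDeriv g₂ p.2 w.2 u.2 v.2) := by
  rw [← fderiv_induced g hφ.smooth,
    Filter.EventuallyEq.fderiv_eq ((hφ.eventually_isometric p).mono fun y h => h u v)]
  have hfst : HasFDerivAt (Prod.fst : E₁ × E₂ → E₁) (ContinuousLinearMap.fst ℝ E₁ E₂)
    (prodCoord p) := hasFDerivAt_fst
  have hsnd : HasFDerivAt (Prod.snd : E₁ × E₂ → E₂) (ContinuousLinearMap.snd ℝ E₁ E₂)
    (prodCoord p) := hasFDerivAt_snd
  have h1 : HasFDerivAt (fun y : E₁ × E₂ => coordMetric g₁ p.1 y.1)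
      (metricDeriv g₁ p.1 ∘L ContinuousLinearMap.fst ℝ E₁ E₂) (prodCoord p) :=
    HasFDerivAt.comp (g := coordMetric g₁ p.1) (f := Prod.fst) (prodCoord p : E₁ × E₂)
      (hasFDerivAt_coordMetric g₁ p.1) hfst
  have h2 : HasFDerivAt (fun y : E₁ × E₂ => coordMetric g₂ p.2 y.2)
      (metricDeriv g₂ p.2 ∘L ContinuousLinearMap.snd ℝ E₁ E₂) (prodCoord p) :=
    HasFDerivAt.comp (g := coordMetric g₂ p.2) (f := Prod.snd) (prodCoord p : E₁ × E₂)
      (hasFDerivAt_coordMetric g₂ p.2) hsnd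
  have h3 : HasFDerivAt (fun y : E₁ × E₂ => f ((extChartAt 𝓘(ℝ, E₁) p.1).symm y.1))
      (warpingDeriv E₁ f p.1 ∘L ContinuousLinearMap.fst ℝ E₁ E₂) (prodCoord p) :=
    HasFDerivAt.comp (g := fun y => f ((extChartAt 𝓘(ℝ, E₁) p.1).symm y))
      (prodCoord p : E₁ × E₂) (hφ.hasFDerivAt_warping p.1) hfst
  have h := DFunLike.congr_fun (((h1.clm_apply (hasFDerivAt_const u.1 _)).clm_apply
    (hasFDerivAt_const v.1 _)).fun_add ((h3.pow 2).fun_mul ((h2.clm_apply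
      (hasFDerivAt_const u.2 _)).clm_apply (hasFDerivAt_const v.2 _)))).fderiv w
  refine Eq.trans h ?_
  have hc1 : coordMetric g₁ p.1 (prodCoord p : E₁ × E₂).1 = rawMetric g₁ p.1 := coordMetric_self _ _
  have hc2 : coordMetric g₂ p.2 (prodCoord p : E₁ × E₂).2 = rawMetric g₂ p.2 := coordMetric_self _ _
  have hc3 : (extChartAt 𝓘(ℝ, E₁) p.1).symm (prodCoord p : E₁ × E₂).1 = p.1 := extChartAt_to_inv _
  simp only [ContinuousLinearMap.comp_zero, zero_add, ContinuousLinearMap.flip_apply,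
    add_apply, ContinuousLinearMap.comp_apply, smul_apply, smul_eq_mul,
    hc1, hc2, hc3, ContinuousLinearMap.coe_fst', ContinuousLinearMap.coe_snd']
  simp
  ring

/-- The Koszul formula for `g(∇̃_u (φ_* v), φ_* w)`. -/
lemma rawMetric_rawAmbientDeriv (hφ : IsSemiSlantWarpedProduct g J g₁ g₂ f φ θ)
    (p : N₁ × N₂) (u v w : E₁ × E₂) {Q : E₁ × E₂ → E₁ × E₂ → E₁ × E₂ → ℝ}
    (hQ : ∀ w u v, Q w u v = metricDeriv g₁ p.1 w.1 u.1 v.1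
        + (2 * f p.1 * warpingDeriv E₁ f p.1 w.1 * rawMetric g₂ p.2 u.2 v.2
          + f p.1 ^ 2 * metricDeriv g₂ p.2 w.2 u.2 v.2)) :
    2 * rawMetric g (φ p) (rawAmbientDeriv g φ p u v) (rawDeriv E E₁ E₂ φ p w)
      = Q u v w + Q v u w - Q w u v := by
  -- Expanding each `Q` by metric compatibility gives six terms, four of which cancel by symmetry.
  simp only [hQ, ← hφ.rawMetric_rawAmbientDeriv_add, rawAmbientDeriv_symm g hφ.smooth p v u,
    rawAmbientDeriv_symm g hφ.smooth p w u, rawAmbientDeriv_symm g hφ.smooth p w v,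
    rawMetric_symm g (φ p) (rawDeriv E E₁ E₂ φ p _) (rawAmbientDeriv g φ p _ _)]
  ring

/-- The tangential part of `∇_X Z` is `X(ln f) Z`: in the Koszul formula only the derivative of `f²`
along `X` survives. -/
lemma rawMetric_rawAmbientDeriv_mixed (hφ : IsSemiSlantWarpedProduct g J g₁ g₂ f φ θ)
    (p : N₁ × N₂) (x : E₁) (z : E₂) (w : E₁ × E₂) :
    rawMetric g (φ p) (rawAmbientDeriv g φ p (x, 0) (0, z)) (rawDeriv E E₁ E₂ φ p w)
      = f p.1 * warpingDeriv E₁ f p.1 x * rawMetric g₂ p.2 z w.2 := by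
  have h := hφ.rawMetric_rawAmbientDeriv p (x, 0) (0, z) w (fun _ _ _ => rfl)
  simp only [map_zero, zero_apply, mul_zero, add_zero, zero_add, sub_zero] at h
  linarith

/-- The `𝔇`-component of `∇_Z Z` is `-|Z|² grad(ln f)`; the derivative of `f²` now enters with the
negative sign of the Koszul formula. -/
lemma rawMetric_rawAmbientDeriv_second (hφ : IsSemiSlantWarpedProduct g J g₁ g₂ f φ θ)
    (p : N₁ × N₂) (x : E₁) (z : E₂) :
    rawMetric g (φ p) (rawAmbientDeriv g φ p ((0 : E₁), z) (0, z))
        (rawDeriv E E₁ E₂ φ p (x, 0))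
      = -(f p.1 * warpingDeriv E₁ f p.1 x * rawMetric g₂ p.2 z z) := by
  have h := hφ.rawMetric_rawAmbientDeriv p (0, z) (0, z) (x, 0) (fun _ _ _ => rfl)
  simp only [map_zero, zero_apply, mul_zero, add_zero, zero_add, zero_sub] at h
  linarith

/-- If `h(X, Z)` is orthogonal to `F Z`, then `g(∇̃_X Z, J Z) = 0`. -/
lemma rawMetric_rawAmbientDeriv_rawEndo (hL : IsLCK g J)
    (hφ : IsSemiSlantWarpedProduct g J g₁ g₂ f φ θ) (p : N₁ × N₂) (x : E₁) (z : E₂)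
    (hh : rawMetric g (φ p)
      (secondFundamentalForm (𝓘(ℝ, E₁).prod 𝓘(ℝ, E₂)) g φ p (x, (0 : E₂)) ((0 : E₁), z))
      (norJ (𝓘(ℝ, E₁).prod 𝓘(ℝ, E₂)) g J φ p ((0 : E₁), z)) = 0) :
    rawMetric g (φ p) (rawAmbientDeriv g φ p (x, 0) (0, z))
      (rawEndo J (φ p) (rawDeriv E E₁ E₂ φ p (0, z))) = 0 := by
  set A : E := rawAmbientDeriv g φ p (x, 0) (0, z) with hA
  set W : E := rawDeriv E E₁ E₂ φ p (0, z) with hW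
  set T : E₁ × E₂ := tangentialPart (𝓘(ℝ, E₁).prod 𝓘(ℝ, E₂)) g φ p A with hT
  set P : E₁ × E₂ := tangentialPart (𝓘(ℝ, E₁).prod 𝓘(ℝ, E₂)) g φ p (rawEndo J (φ p) W) with hP
  set H : E := A - rawDeriv E E₁ E₂ φ p T with hH
  set F : E := rawEndo J (φ p) W - rawDeriv E E₁ E₂ φ p P with hF
  have hsff : secondFundamentalForm (𝓘(ℝ, E₁).prod 𝓘(ℝ, E₂)) g φ p
      (x, (0 : E₂)) ((0 : E₁), z) = H := by
    unfold secondFundamentalForm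
    rw [ambientDeriv_eq]
    rfl
  have hhF : rawMetric g (φ p) H F = 0 := by
    rw [← hsff]
    exact hh
  have hFn (w : E₁ × E₂) : rawMetric g (φ p) F (rawDeriv E E₁ E₂ φ p w) = 0 :=
    hφ.rawMetric_normalPart p _ w
  -- `JZ ⊥ Z` by skewness, so `PZ ⊥ Z`; dividing by `f²` passes to `g₂`.
  have hPz : rawMetric g₂ p.2 z P.2 = 0 := by
    have h1 := hφ.rawMetric_tangentialPart p (rawEndo J (φ p) W) (0, z)
    have h2 := hL.rawMetric_rawEndo_left (φ p) W W
    rw [rawMetric_symm g (φ p) W] at h2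
    have h3 : rawMetric g (φ p) (rawEndo J (φ p) W) W = 0 := by linarith
    rw [← hW, ← hP, h3, rawMetric_symm, hφ.rawMetric_rawDeriv] at h1
    simp only [map_zero, zero_apply, zero_add, mul_eq_zero] at h1
    exact h1.resolve_left (pow_pos (hφ.warping_pos p.1) 2).ne'
  have hsplit : rawEndo J (φ p) W = rawDeriv E E₁ E₂ φ p P + F := by rw [hF]; abel
  have hAsplit : A = H + rawDeriv E E₁ E₂ φ p T := by rw [hH]; abel
  rw [hsplit, map_add, hφ.rawMetric_rawAmbientDeriv_mixed, hPz, hAsplit, map_add, add_apply, hhF,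
    rawMetric_symm g (φ p) _ F, hFn]
  simp

/-- The Lee form on the holomorphic distribution, when `h(X, Z)` is orthogonal to `F Z`. -/
theorem leeForm_eq (hL : IsLCK g J) {α : (x : M) → TangentSpace 𝓘(ℝ, E) x →L[ℝ] ℝ}
    (hα : IsLeeForm g J α) (hφ : IsSemiSlantWarpedProduct g J g₁ g₂ f φ θ)
    (hdim : 0 < Module.finrank ℝ E₂) (p : N₁ × N₂)
    (hh : ∀ (x : E₁) (z : E₂), rawMetric g (φ p)
      (secondFundamentalForm (𝓘(ℝ, E₁).prod 𝓘(ℝ, E₂)) g φ p (x, (0 : E₂)) ((0 : E₁), z))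
      (norJ (𝓘(ℝ, E₁).prod 𝓘(ℝ, E₂)) g J φ p ((0 : E₁), z)) = 0) (t : E₁) :
    rawForm α (φ p) (rawDeriv E E₁ E₂ φ p (t, 0)) = warpingDeriv E₁ f p.1 t / f p.1 := by
  have := Module.nontrivial_of_finrank_pos hdim
  obtain ⟨z, hz⟩ := exists_ne (0 : E₂)
  -- `X = -JT`, so that `JX = T` is the given vector.
  obtain ⟨x, hx⟩ : ∃ x : E₁, rawEndo J (φ p) (rawDeriv E E₁ E₂ φ p (x, 0))
      = rawDeriv E E₁ E₂ φ p (t, 0) := by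
    obtain ⟨x, hx⟩ := hφ.exists_rawEndo_eq p t
    refine ⟨-x, ?_⟩
    have : ((-x, 0) : E₁ × E₂) = -(x, 0) := by simp
    rw [this, map_neg, ← hx, map_neg, hL.rawEndo_sq, neg_neg]
  have hX : rawMetric g (φ p) (rawDeriv E E₁ E₂ φ p (x, 0)) (rawDeriv E E₁ E₂ φ p (0, z)) = 0 := by
    rw [hφ.rawMetric_rawDeriv]
    simp
  have h := fderiv_rawEndo g hL.complex hφ.smooth p (0, z) (x, 0) (0, z)
  have hconst := Filter.EventuallyEq.fderiv_eq (𝕜 := ℝ) (f := fun _ => (0 : ℝ))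
    (hφ.eventually_rawEndo_orthogonal p x z)
  rw [hconst, hL.rawMetric_covDeriv hα (φ p) hX (hφ.rawMetric_rawEndo_eq_zero p x z),
    hL.rawMetric_rawEndo_left, rawAmbientDeriv_symm g hφ.smooth p (0, z) (x, 0),
    hφ.rawMetric_rawAmbientDeriv_rawEndo hL p x z (hh x z), hx,
    rawMetric_symm g (φ p) (rawDeriv E E₁ E₂ φ p (t, 0)), hφ.rawMetric_rawAmbientDeriv_second,
    hφ.rawMetric_rawDeriv] at h
  simp only [fderiv_fun_const, Pi.zero_apply, zero_apply, map_zero, zero_add, neg_zero, add_zero] at h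
  have hf := hφ.warping_pos p.1
  have hzz := rawMetric_pos g₂ p.2 hz
  rw [eq_div_iff hf.ne']
  -- What remains is `α(T) f² |z|² = f df(T) |z|²`, up to the common factor `f |z|²`.
  refine mul_left_cancel₀ (mul_pos hf hzz).ne' ?_
  linarith

end IsSemiSlantWarpedProduct

end WarpedProducts

end LCK

end

theorem theorem4p1
    {E : Type*} [NormedAddCommGroup E] [NormedSpace ℝ E] [FiniteDimensional ℝ E]
    {M : Type*} [TopologicalSpace M] [ChartedSpace E M] [IsManifold 𝓘(ℝ, E) ∞ M]
    {E₁ : Type*} [NormedAddCommGroup E₁] [NormedSpace ℝ E₁] [FiniteDimensional ℝ E₁]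
    {N₁ : Type*} [TopologicalSpace N₁] [ChartedSpace E₁ N₁] [IsManifold 𝓘(ℝ, E₁) ∞ N₁]
    {E₂ : Type*} [NormedAddCommGroup E₂] [NormedSpace ℝ E₂] [FiniteDimensional ℝ E₂]
    {N₂ : Type*} [TopologicalSpace N₂] [ChartedSpace E₂ N₂] [IsManifold 𝓘(ℝ, E₂) ∞ N₂]
    (g : LCK.Metric E M)
    (J : (x : M) → TangentSpace 𝓘(ℝ, E) x →L[ℝ] TangentSpace 𝓘(ℝ, E) x)
    (hLCK : LCK.IsLCK g J)
    (α : (x : M) → TangentSpace 𝓘(ℝ, E) x →L[ℝ] ℝ) (hα : LCK.IsLeeForm g J α)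
    (g₁ : LCK.Metric E₁ N₁) (g₂ : LCK.Metric E₂ N₂) (f : N₁ → ℝ)
    (φ : N₁ × N₂ → M) (θ : N₁ × N₂ → ℝ)
    (hφ : LCK.IsSemiSlantWarpedProduct g J g₁ g₂ f φ θ)
    (hdim : 0 < Module.finrank ℝ E₂) :
    -- proper, with `h(X, Z) ∈ ν`
    (0 < Module.finrank ℝ E₁ → (∀ p, 0 < Real.cos (θ p) ^ 2) →
      (∀ p, ∀ X ∈ LCK.firstDist E₁ E₂ p, ∀ Z ∈ LCK.secondDist E₁ E₂ p,
        LCK.MemNu (𝓘(ℝ, E₁).prod 𝓘(ℝ, E₂)) g J φ (LCK.secondDist E₁ E₂) p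
          (LCK.secondFundamentalForm (𝓘(ℝ, E₁).prod 𝓘(ℝ, E₂)) g φ p X Z)) →
      ∀ p, ∀ X ∈ LCK.firstDist E₁ E₂ p,
        α (φ p) (mfderiv (𝓘(ℝ, E₁).prod 𝓘(ℝ, E₂)) 𝓘(ℝ, E) φ p X)
          = mfderiv (𝓘(ℝ, E₁).prod 𝓘(ℝ, E₂)) 𝓘(ℝ, ℝ)
              (fun q : N₁ × N₂ => Real.log (f q.1)) p X) ∧
    -- mixed totally geodesic
    (LCK.IsMixedTotallyGeodesic (𝓘(ℝ, E₁).prod 𝓘(ℝ, E₂)) g φ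
        (LCK.firstDist E₁ E₂) (LCK.secondDist E₁ E₂) →
      ∀ p, ∀ X ∈ LCK.firstDist E₁ E₂ p,
        α (φ p) (mfderiv (𝓘(ℝ, E₁).prod 𝓘(ℝ, E₂)) 𝓘(ℝ, E) φ p X)
          = mfderiv (𝓘(ℝ, E₁).prod 𝓘(ℝ, E₂)) 𝓘(ℝ, ℝ)
              (fun q : N₁ × N₂ => Real.log (f q.1)) p X) := by
  -- Both parts reduce to `g(h(X, Z), FZ) = 0`, with the same `Z` in both slots.
  have key (p : N₁ × N₂) (hh : ∀ X ∈ LCK.firstDist E₁ E₂ p, ∀ Z ∈ LCK.secondDist E₁ E₂ p,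
      g.inner (φ p) (LCK.secondFundamentalForm (𝓘(ℝ, E₁).prod 𝓘(ℝ, E₂)) g φ p X Z)
        (LCK.norJ (𝓘(ℝ, E₁).prod 𝓘(ℝ, E₂)) g J φ p Z) = 0)
      (X : TangentSpace (𝓘(ℝ, E₁).prod 𝓘(ℝ, E₂)) p) (hX : X ∈ LCK.firstDist E₁ E₂ p) :
      α (φ p) (mfderiv (𝓘(ℝ, E₁).prod 𝓘(ℝ, E₂)) 𝓘(ℝ, E) φ p X)
        = mfderiv (𝓘(ℝ, E₁).prod 𝓘(ℝ, E₂)) 𝓘(ℝ, ℝ)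
            (fun q : N₁ × N₂ => Real.log (f q.1)) p X := by
    obtain ⟨t, s⟩ := X
    obtain rfl : s = 0 := (LCK.mem_firstDist_iff p (t, s)).1 hX
    refine Eq.trans ?_ (hφ.mfderiv_log_warping p (t, 0)).symm
    exact hφ.leeForm_eq hLCK hα hdim p (fun x z => hh (x, 0)
      ((LCK.mem_firstDist_iff p (x, (0 : E₂))).2 rfl) (0, z)
      ((LCK.mem_secondDist_iff p ((0 : E₁), z)).2 rfl)) t
  refine ⟨fun _ _ h p X hX => key p (fun X hX Z hZ => (h p X hX Z hZ).2 Z hZ) X hX,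
    fun h p X hX => key p (fun X hX Z hZ => ?_) X hX⟩
  rw [h p X hX Z hZ, map_zero]
  rfl
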